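/- Let $(\varepsilon_i)_{i\ge1}$ be independent square-integrable random variables on a probability space $(\Omega,\mathcal F,P)$ with $E\varepsilon_i=0$, $E\varepsilon_i^2=1$ for all $i$ and $\sup_i E|\varepsilon_i|^3<\infty$, and let $b=(b_i)_{i\ge1}\in\ell_2$ be a real sequence such that $P(\varepsilon_i>b_i)>0$ and $P(\varepsilon_i<b_i)>0$ for all $i$. For $x\in\mathbb R$ and $h\in\ell_2$ let $V^{x,h}:=x+\sum_{i\ge1}h_i(\varepsilon_i-b_i)$, the series being the $L^2(P)$-limit of its partial sums. For a random variable $G$ and $x\in\mathbb R$ put $$\mathcal A(G,x):=\{h\in\ell_2:\ V^{x,h}\ge G\ \text{a.s.}\},\qquad \pi(G):=\inf\{z\in\mathbb R:\ \mathcal A(G,z)\ne\emptyset\},$$ with $\inf\emptyset=+\infty$ ($\pi(G)$ is the superreplication price of $G$). Let $U_n:\,]0,\infty[\,\to\mathbb R$, $n\in\mathbb N$, be concave, strictly increasing and twice continuously differentiable functions such that $-U_n''(y)/U_n'(y)\to\infty$ as $n\to\infty$, for every $y\in\,]0,\infty[$. Extend $U_n$ by $U_n(0):=\lim_{y\downarrow0}U_n(y)\in[-\infty,\infty[$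 and $U_n(y):=-\infty$ for $y<0$. Put $$\mathcal A(U_n,G,x):=\{h\in\mathcal A(G,x):\ E\,U_n^+(V^{x,h}-G)<\infty\},\qquad u_n(G,x):=\sup_{h\in\mathcal A(U_n,G,x)}E\,U_n(V^{x,h}-G),$$ with $\sup\emptyset=-\infty$, and define the utility indifference price $$p_n(G,x):=\inf\{z\in\mathbb R:\ u_n(G,x+z)\ge u_n(0,x)\},\qquad \inf\emptyset=+\infty.$$ Let $x>0$ and let $G\in L^2(P)$ with $G\ge0$ a.s. Then the utility indifference prices are well defined: for every $n$ and $y\in\mathbb R$ one has $\mathcal A(U_n,G,y)=\mathcal A(G,y)$, $\mathcal A(U_n,0,y)=\mathcal A(0,y)$ and $u_n(G,y)<\infty$; moreover $u_n(0,x)$ is finite, $p_n(G,x)>-\infty$, and $p_n(G,x)<\infty$ if and only if $\pi(G)<\infty$. Furthermore, $p_n(G,x)\to\pi(G)$ in $]-\infty,+\infty]$ as $n\to\infty$. -/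

import Mathlib

open MeasureTheory ProbabilityTheory Filter Topology Set

noncomputable section

namespace APT

variable {Ω : Type*} [MeasurableSpace Ω]

/-- The Hilbert space of square-summable real sequences. The index `i : ℕ` plays the role of the
`(i + 1)`-st source of risk. -/
abbrev Ell2 : Type := lp (fun _ : ℕ => ℝ) 2

/-- Gain `∑ h_i (ε_i - b_i)` of the strategy `h` in the first `n` sources of risk. -/
def partialGain (ε : ℕ → Ω → ℝ) (b : ℕ → ℝ) (h : Ell2) (n : ℕ) : Ω → ℝ :=
  fun ω => ∑ i ∈ Finset.range n, h i * (ε i ω - b i)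

/-- `X` is the limit in `L²(P)` of the finite gains of the strategy `h`. -/
def IsGain (P : Measure Ω) (ε : ℕ → Ω → ℝ) (b : ℕ → ℝ) (h : Ell2) (X : Ω → ℝ) : Prop :=
  MemLp X 2 P ∧
    Tendsto (fun n => eLpNorm (fun ω => partialGain ε b h n ω - X ω) 2 P) atTop (𝓝 0)

open Classical in
/-- `⟨h, ε - b⟩`: the (almost surely unique) limit in `L²(P)` of the finite gains of `h`. That the
limit exists for every `h` in the model under consideration is `isGain_gain` below. -/
def gain (P : Measure Ω) (ε : ℕ → Ω → ℝ) (b : ℕ → ℝ) (h : Ell2) : Ω → ℝ :=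
  if H : ∃ X, IsGain P ε b h X then H.choose else 0

theorem exists_isGain {P : Measure Ω} [IsProbabilityMeasure P] {ε : ℕ → Ω → ℝ} {b : ℕ → ℝ}
    (hL2 : ∀ i, MemLp (ε i) 2 P) (hind : iIndepFun ε P) (hmean : ∀ i, ∫ ω, ε i ω ∂P = 0)
    (hvar : ∀ i, ∫ ω, ε i ω ^ 2 ∂P = 1) (hb : Memℓp b 2) (h : Ell2) :
    ∃ X, IsGain P ε b h X := by
  classical
  set f : ℕ → Lp ℝ 2 P := fun i => (hL2 i).toLp with hf
  have hfi : Orthonormal ℝ f := by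
    rw [orthonormal_iff_ite]
    intro i j
    have h1 : inner ℝ (f i) (f j) = ∫ ω, ε i ω * ε j ω ∂P := by
      rw [L2.inner_def]
      refine integral_congr_ae ?_
      filter_upwards [(hL2 i).coeFn_toLp, (hL2 j).coeFn_toLp] with ω h2 h3
      simp only [hf, h2, h3]
      simp [mul_comm]
    rw [h1]
    split_ifs with hij
    · subst hij
      simpa [sq] using hvar i
    · rw [(hind.indepFun hij).integral_fun_mul_eq_mul_integral (hL2 i).1 (hL2 j).1, hmean i,
        zero_mul]
  have hsum1 : Summable fun i => h i • f i := by
    have := (hfi.orthogonalFamily).summable_iff_norm_sq_summable (fun i => h i)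
    simp only [LinearIsometry.toSpanSingleton_apply] at this
    rw [this]
    have := lp.memℓp h
    rw [memℓp_gen_iff (by norm_num)] at this
    simpa using this
  have hsum2 : Summable fun i => h i * b i := by
    have := lp.summable_inner (𝕜 := ℝ) (⟨b, hb⟩ : Ell2) h
    simpa using this
  have hc : ∀ i, MemLp (fun ω => ε i ω - b i) 2 P := fun i => (hL2 i).sub (memLp_const _)
  set one : Lp ℝ 2 P := (memLp_const (1 : ℝ)).toLp with hone
  have hT := hsum1.hasSum.tendsto_sum_nat.sub
    ((hsum2.hasSum.tendsto_sum_nat).smul_const one)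
  have hpm : ∀ n, MemLp (partialGain ε b h n) 2 P := fun n =>
    memLp_finsetSum _ fun i _ => (hc i).const_mul (h i)
  set L := (∑' i, h i • f i) - (∑' i, h i * b i) • one with hL
  have hp : ∀ n, (hpm n).toLp =
      (∑ i ∈ Finset.range n, h i • f i) - (∑ i ∈ Finset.range n, h i * b i) • one := by
    intro n
    induction n with
    | zero => simp; rfl
    | succ n ih =>
      have e : (hpm (n + 1)).toLp = (hpm n).toLp + (h n • f n - (h n * b n) • one) := by
        rw [hf, hone, ← MemLp.toLp_const_smul, ← MemLp.toLp_const_smul, ← MemLp.toLp_sub,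
          ← MemLp.toLp_add]
        congr 1
        funext ω
        simp [partialGain, Finset.sum_range_succ]
        ring
      rw [e, ih, Finset.sum_range_succ, Finset.sum_range_succ, add_smul]
      abel
  refine ⟨L, Lp.memLp L, ?_⟩
  have := (Lp.tendsto_Lp_iff_tendsto_eLpNorm'' (fun n => partialGain ε b h n) hpm L
    (Lp.memLp L)).1 (by simpa [hp, Lp.toLp_coeFn] using hT)
  exact this

theorem isGain_gain {P : Measure Ω} [IsProbabilityMeasure P] {ε : ℕ → Ω → ℝ} {b : ℕ → ℝ}
    (hL2 : ∀ i, MemLp (ε i) 2 P) (hind : iIndepFun ε P) (hmean : ∀ i, ∫ ω, ε i ω ∂P = 0)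
    (hvar : ∀ i, ∫ ω, ε i ω ^ 2 ∂P = 1) (hb : Memℓp b 2) (h : Ell2) :
    IsGain P ε b h (gain P ε b h) := by
  have H := exists_isGain hL2 hind hmean hvar hb h
  rw [gain, dif_pos H]
  exact H.choose_spec

/-- Terminal value `V^{x,h} = x + ⟨h, ε - b⟩` of the strategy `h` from initial wealth `x`. -/
def wealth (P : Measure Ω) (ε : ℕ → Ω → ℝ) (b : ℕ → ℝ) (x : ℝ) (h : Ell2) : Ω → ℝ :=
  fun ω => x + gain P ε b h ω

/-- `𝒜(G, x)`: the strategies that superreplicate `G` almost surely from initial wealth `x`. -/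
def superhedging (P : Measure Ω) (ε : ℕ → Ω → ℝ) (b : ℕ → ℝ) (G : Ω → ℝ) (x : ℝ) : Set Ell2 :=
  {h | ∀ᵐ ω ∂P, G ω ≤ wealth P ε b x h ω}

/-- The superreplication price `π(G)`; it is `⊤` if no initial wealth suffices. -/
def superPrice (P : Measure Ω) (ε : ℕ → Ω → ℝ) (b : ℕ → ℝ) (G : Ω → ℝ) : EReal :=
  ⨅ (z : ℝ) (_ : (superhedging P ε b G z).Nonempty), (z : EReal)

/-- Extension of a utility function on `]0, ∞[` to the real line: by its right limit at `0`
(possibly `⊥`), and by `⊥` on `]-∞, 0[`. -/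
def extendUtility (U : ℝ → ℝ) (y : ℝ) : EReal :=
  if 0 < y then (U y : EReal)
  else if y = 0 then Function.rightLim (fun t : ℝ => (U t : EReal)) 0
  else ⊥

/-- `E U⁺(Y)`. -/
def expUtilityPos (P : Measure Ω) (U : ℝ → ℝ) (Y : Ω → ℝ) : ENNReal :=
  ∫⁻ ω, (extendUtility U (Y ω)).toENNReal ∂P

/-- `E U⁻(Y)`. -/
def expUtilityNeg (P : Measure Ω) (U : ℝ → ℝ) (Y : Ω → ℝ) : ENNReal :=
  ∫⁻ ω, (-extendUtility U (Y ω)).toENNReal ∂P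

/-- Expected utility `E U(Y) = E U⁺(Y) - E U⁻(Y)`, used only where `E U⁺(Y) < ∞`; it may be `⊥`. -/
def expUtility (P : Measure Ω) (U : ℝ → ℝ) (Y : Ω → ℝ) : EReal :=
  (expUtilityPos P U Y : EReal) - (expUtilityNeg P U Y : EReal)

/-- `Φ(U, G, x)`: the strategies for which `E U⁺(V^{x,h} - G) < ∞`. -/
def wellDefinedStrategies (P : Measure Ω) (ε : ℕ → Ω → ℝ) (b : ℕ → ℝ) (U : ℝ → ℝ) (G : Ω → ℝ)
    (x : ℝ) : Set Ell2 :=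
  {h | expUtilityPos P U (fun ω => wealth P ε b x h ω - G ω) < ⊤}

/-- `𝒜(U, G, x) = Φ(U, G, x) ∩ 𝒜(G, x)`. -/
def admissible (P : Measure Ω) (ε : ℕ → Ω → ℝ) (b : ℕ → ℝ) (U : ℝ → ℝ) (G : Ω → ℝ)
    (x : ℝ) : Set Ell2 :=
  wellDefinedStrategies P ε b U G x ∩ superhedging P ε b G x

/-- The value function `u(G, x)`: the supremum of the expected utility of `V^{x,h} - G` over
`𝒜(U, G, x)`; it is `⊥` if there is no admissible strategy. -/
def valueFn (P : Measure Ω) (ε : ℕ → Ω → ℝ) (b : ℕ → ℝ) (U : ℝ → ℝ) (G : Ω → ℝ)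
    (x : ℝ) : EReal :=
  ⨆ h ∈ admissible P ε b U G x, expUtility P U (fun ω => wealth P ε b x h ω - G ω)

/-- The utility indifference price `p(G, x) = inf {z : u(G, x + z) ≥ u(0, x)}`. -/
def indiffPrice (P : Measure Ω) (ε : ℕ → Ω → ℝ) (b : ℕ → ℝ) (U : ℝ → ℝ) (G : Ω → ℝ)
    (x : ℝ) : EReal :=
  ⨅ (z : ℝ) (_ : valueFn P ε b U 0 x ≤ valueFn P ε b U G (x + z)), (z : EReal)

/-- Absolute risk aversion `-U'' / U'`. -/
def riskAversion (U : ℝ → ℝ) (y : ℝ) : ℝ :=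
  -deriv (deriv U) y / deriv U y

end APT

end

/-! The bound `p_n ≤ π(G)` holds for every `n`: if `g` superhedges `G` from `z`, adding `g` to any
competitor `h` in `u_n(0, x)` leaves a surplus over `G` of at least `V^{x,h}`, so `u_n(G, x + z) ≥
u_n(0, x)`.

For the lower bound fix `z < π(G)` and let `K = 𝒜(G, x + z)`. No element of `K` superhedges `G` from
`z`, so the convex continuous functional `h ↦ ‖(G - V^{z,h})⁺‖₂` is positive on `K`. Since `K` is
closed, convex and bounded, weak compactness gives a lower bound `m > 0`
(`exists_pos_le_of_continuous_convexOn`). The surplus `W = V^{x+z,h} - G ≥ 0` therefore falls below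
`x` by a definite amount on average, uniformly in `h`. Bounding `U` by its tangents at some `a < x`
and at `x` yields `u_n(G, x + z) ≤ U_n(x) - σ U_n'(a) + C U_n'(x)` with `a`, `σ`, `C` independent of
`n` (`exists_valueFn_le`). Risk aversion is the derivative of `-log U_n'`, so `U_n'(a) / U_n'(x) →
∞` by Fatou, and eventually `u_n(G, x + z) < U_n(x) ≤ u_n(0, x)`, hence `p_n ≥ z`.

Boundedness of `K` (`exists_norm_le_of_neg_le_gain`) rests on two facts. Bounded third moments make
the `L¹` norm of `∑ h_i ε_i` comparable to `‖h‖` (`norm_le_integral_abs_isometry`), and there is no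
arbitrage: a nonnegative gain forces `h = 0` (`eq_zero_of_gain_nonneg`). -/

/-! ### Weak compactness in Hilbert space, by minimal norm elements. -/

section Hilbert

variable {F : Type*} [NormedAddCommGroup F] [InnerProductSpace ℝ F] [CompleteSpace F]

/-- A decreasing sequence of nonempty bounded closed convex sets in a Hilbert space has a
common point: the limit of the elements of minimal norm. -/
theorem nonempty_iInter_of_antitone_closed_convex_bounded {K : ℕ → Set F} (hanti : Antitone K)
    (hclosed : ∀ n, IsClosed (K n)) (hconv : ∀ n, Convex ℝ (K n)) (hne : ∀ n, (K n).Nonempty)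
    (hbdd : Bornology.IsBounded (K 0)) : (⋂ n, K n).Nonempty := by
  have hex : ∀ n, ∃ v ∈ K n, ∀ w ∈ K n, ‖v‖ ^ 2 ≤ inner ℝ v w := by
    intro n
    obtain ⟨v, hv, hmin⟩ := exists_norm_eq_iInf_of_complete_convex (hne n)
      (hclosed n).isComplete (hconv n) 0
    refine ⟨v, hv, fun w hw => ?_⟩
    have h := (norm_eq_iInf_iff_real_inner_le_zero (hconv n) hv).1 hmin w hw
    rw [zero_sub, inner_neg_left, inner_sub_right, real_inner_self_eq_norm_sq] at h
    linarith
  choose v hv hvmin using hex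
  -- The variational inequality for `v n`, tested at `v m ∈ K n`, lets the increments of the bounded
  -- monotone sequence `‖v n‖ ^ 2` control distances.
  have hdist : ∀ n m, n ≤ m → ‖v m - v n‖ ^ 2 ≤ ‖v m‖ ^ 2 - ‖v n‖ ^ 2 := by
    intro n m hnm
    have h := hvmin n (v m) (hanti hnm (hv m))
    rw [norm_sub_sq_real, real_inner_comm]
    linarith
  have hmono : Monotone fun n => ‖v n‖ ^ 2 := fun n m hnm => by
    have := hdist n m hnm
    have := sq_nonneg ‖v m - v n‖
    simp only
    linarith
  obtain ⟨R, hR⟩ := hbdd.exists_norm_le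
  have hcauchy : CauchySeq fun n => ‖v n‖ ^ 2 := by
    refine (tendsto_atTop_ciSup hmono ⟨R ^ 2, ?_⟩).cauchySeq
    rintro _ ⟨n, rfl⟩
    exact pow_le_pow_left₀ (norm_nonneg _) (hR _ (hanti (Nat.zero_le n) (hv n))) 2
  have hvc : CauchySeq v := by
    rw [Metric.cauchySeq_iff'] at hcauchy ⊢
    intro δ hδ
    obtain ⟨N, hN⟩ := hcauchy (δ ^ 2) (by positivity)
    refine ⟨N, fun n hn => ?_⟩
    have h1 := hN n hn
    rw [Real.dist_eq] at h1
    have h2 := (hdist N n hn).trans_lt ((le_abs_self _).trans_lt h1)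
    rw [dist_eq_norm]
    exact lt_of_pow_lt_pow_left₀ 2 hδ.le h2
  obtain ⟨z, hz⟩ := cauchySeq_tendsto_of_complete hvc
  refine ⟨z, mem_iInter.2 fun n => (hclosed n).mem_of_tendsto hz ?_⟩
  filter_upwards [eventually_ge_atTop n] with m hm using hanti hm (hv m)

/-- A continuous convex function that is positive on a bounded closed convex subset of a Hilbert
space is bounded away from zero there. -/
theorem exists_pos_le_of_continuous_convexOn {K : Set F} (hclosed : IsClosed K)
    (hconv : Convex ℝ K) (hbdd : Bornology.IsBounded K) {f : F → ℝ} (hf : Continuous f)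
    (hfc : ConvexOn ℝ univ f) (hpos : ∀ x ∈ K, 0 < f x) : ∃ m > 0, ∀ x ∈ K, m ≤ f x := by
  by_contra! hcon
  have hpos' : ∀ n : ℕ, (0 : ℝ) < 1 / (n + 1) := fun n => by positivity
  -- If the infimum were zero, the sublevel sets at heights `1 / (n + 1)` would all be nonempty, and
  -- a common point would be a zero of `f`.
  obtain ⟨z, hz⟩ := nonempty_iInter_of_antitone_closed_convex_bounded
    (K := fun n : ℕ => K ∩ {x | f x ≤ 1 / (n + 1)})
    (fun n m hnm x hx => ⟨hx.1, le_trans (mem_ofPred.1 hx.2) (Nat.one_div_le_one_div hnm)⟩)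
    (fun n => hclosed.inter (isClosed_le hf continuous_const))
    (fun n => hconv.inter (by simpa using hfc.convex_le (1 / ((n : ℝ) + 1))))
    (fun n => by
      obtain ⟨x, hx, hxf⟩ := hcon _ (hpos' n)
      exact ⟨x, hx, hxf.le⟩)
    (hbdd.subset inter_subset_left)
  rw [mem_iInter] at hz
  refine absurd (hpos z (hz 0).1) (not_lt.2 ?_)
  exact ge_of_tendsto' tendsto_one_div_add_atTop_nhds_zero_nat fun n => (hz n).2

end Hilbert

/-! ### An elementary inequality for third absolute moments. -/

section ThirdMoment

/-- The term linear in `y` is kept exact, not estimated by absolute values, so that it has zero mean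
when `y` is centred and independent of `x`. -/
theorem abs_add_pow_three_le (x y : ℝ) :
    |x + y| ^ 3 ≤ |x| ^ 3 + 3 * (x * |x| * y) + 3 * (|x| * y ^ 2) + |y| ^ 3 := by
  have key : ∀ x y : ℝ, 0 ≤ x →
      |x + y| ^ 3 ≤ x ^ 3 + 3 * (x * x * y) + 3 * (x * y ^ 2) + |y| ^ 3 := by
    intro x y hx
    rcases le_total 0 (x + y) with h | h
    · rw [abs_of_nonneg h]
      have : y ^ 3 ≤ |y| ^ 3 := by rw [← abs_pow]; exact le_abs_self _
      nlinarith
    · have hy : y ≤ 0 := by linarith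
      rw [abs_of_nonpos h, abs_of_nonpos hy]
      have : (-(x + y)) ^ 3 ≤ (-y) ^ 3 := pow_le_pow_left₀ (by linarith) (by linarith) 3
      nlinarith
  rcases le_total 0 x with hx | hx
  · simpa only [abs_of_nonneg hx] using key x y hx
  · have h := key (-x) (-y) (by linarith)
    rw [← neg_add, abs_neg, abs_neg] at h
    rw [abs_of_nonpos hx]
    linarith

end ThirdMoment

/-! ### Utility functions and their marginal utilities. -/

section Utility

/-- A strictly increasing, concave and twice continuously differentiable function on `]0, ∞[`. -/
structure IsUtility (U : ℝ → ℝ) : Prop where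
  concave : ConcaveOn ℝ (Ioi 0) U
  strictMono : StrictMonoOn U (Ioi 0)
  contDiff : ContDiffOn ℝ 2 U (Ioi 0)

namespace IsUtility

variable {U : ℝ → ℝ}

theorem differentiableAt (hU : IsUtility U) {y : ℝ} (hy : 0 < y) : DifferentiableAt ℝ U y :=
  (hU.contDiff.differentiableOn (by norm_num)).differentiableAt (Ioi_mem_nhds hy)

theorem le_tangent (hU : IsUtility U) {y t : ℝ} (hy : 0 < y) (ht : 0 < t) :
    U t ≤ U y + deriv U y * (t - y) := by
  rcases lt_trichotomy y t with h | h | h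
  · have h1 := hU.concave.slope_le_deriv hy ht h (hU.differentiableAt hy)
    rw [slope_def_field, div_le_iff₀ (by linarith)] at h1
    linarith
  · simp [h]
  · have h1 := hU.concave.deriv_le_slope ht hy h (hU.differentiableAt hy)
    rw [slope_def_field, le_div_iff₀ (by linarith)] at h1
    linarith

theorem deriv_pos (hU : IsUtility U) {y : ℝ} (hy : 0 < y) : 0 < deriv U y := by
  have h1 := hU.le_tangent hy (show (0 : ℝ) < y + 1 by linarith)
  have h2 := hU.strictMono hy (show (0 : ℝ) < y + 1 by linarith) (lt_add_one y)
  linarith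

theorem contDiffOn_deriv (hU : IsUtility U) : ContDiffOn ℝ 1 (deriv U) (Ioi 0) :=
  ((contDiffOn_succ_iff_deriv_of_isOpen (n := 1) isOpen_Ioi).1
    (by simpa [one_add_one_eq_two] using hU.contDiff)).2.2

theorem hasDerivAt_log_deriv (hU : IsUtility U) {y : ℝ} (hy : 0 < y) :
    HasDerivAt (fun t => -Real.log (deriv U t)) (APT.riskAversion U y) y := by
  have h1 : HasDerivAt (deriv U) (deriv (deriv U) y) y :=
    ((hU.contDiffOn_deriv.differentiableOn (by norm_num)).differentiableAt
      (Ioi_mem_nhds hy)).hasDerivAt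
  have h2 := (h1.log (hU.deriv_pos hy).ne').neg
  rwa [← neg_div] at h2

theorem continuousOn_riskAversion (hU : IsUtility U) :
    ContinuousOn (APT.riskAversion U) (Ioi 0) :=
  (hU.contDiffOn_deriv.continuousOn_deriv_of_isOpen isOpen_Ioi le_rfl).neg.div
    hU.contDiffOn_deriv.continuousOn fun _ hy => (hU.deriv_pos hy).ne'

theorem riskAversion_nonneg (hU : IsUtility U) {y : ℝ} (hy : 0 < y) :
    0 ≤ APT.riskAversion U y := by
  refine div_nonneg (neg_nonneg.2 ?_) (hU.deriv_pos hy).le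
  have hanti : AntitoneOn (deriv U) (Ioi 0) :=
    hU.concave.antitoneOn_deriv fun t ht => hU.differentiableAt ht
  rw [← derivWithin_of_isOpen isOpen_Ioi hy]
  exact hanti.derivWithin_nonpos

/-- Risk aversion is the derivative of `-log U'`. The lower integral form is the one to which
Fatou's lemma applies. -/
theorem log_deriv_sub_log_deriv (hU : IsUtility U) {a x : ℝ} (ha : 0 < a) (hax : a ≤ x) :
    ENNReal.ofReal (Real.log (deriv U a) - Real.log (deriv U x)) =
      ∫⁻ y in Ioc a x, ENNReal.ofReal (APT.riskAversion U y) := by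
  have hsub : Icc a x ⊆ Ioi 0 := fun y hy => ha.trans_le hy.1
  have hcont : ContinuousOn (APT.riskAversion U) (uIcc a x) := by
    rw [uIcc_of_le hax]
    exact hU.continuousOn_riskAversion.mono hsub
  have h1 := intervalIntegral.integral_eq_sub_of_hasDerivAt
    (fun y hy => hU.hasDerivAt_log_deriv (hsub (by rwa [uIcc_of_le hax] at hy)))
    hcont.intervalIntegrable
  rw [← ofReal_integral_eq_lintegral_ofReal
    ((intervalIntegrable_iff_integrableOn_Ioc_of_le hax).1 hcont.intervalIntegrable)
    ((ae_restrict_iff' measurableSet_Ioc).2 (ae_of_all _ fun y hy =>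
      hU.riskAversion_nonneg (ha.trans hy.1))), ← intervalIntegral.integral_of_le hax, h1]
  congr 1
  ring

/-- If the risk aversions tend to infinity pointwise, so do the ratios of marginal utilities. -/
theorem tendsto_deriv_div_deriv {U : ℕ → ℝ → ℝ} (hU : ∀ n, IsUtility (U n))
    (hra : ∀ y : ℝ, 0 < y → Tendsto (fun n => APT.riskAversion (U n) y) atTop atTop)
    {a x : ℝ} (ha : 0 < a) (hax : a < x) :
    Tendsto (fun n => deriv (U n) a / deriv (U n) x) atTop atTop := by
  -- Risk aversions are nonnegative, so Fatou needs only their pointwise divergence; the integrals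
  -- over `Ioc a x` then tend to infinity.
  have hfatou : ∫⁻ y in Ioc a x, liminf (fun n => ENNReal.ofReal (APT.riskAversion (U n) y)) atTop ≤
      liminf (fun n => ∫⁻ y in Ioc a x, ENNReal.ofReal (APT.riskAversion (U n) y)) atTop := by
    refine lintegral_liminf_le' fun n => AEMeasurable.ennreal_ofReal ?_
    exact ((hU n).continuousOn_riskAversion.mono fun y hy => ha.trans hy.1).aemeasurable
      measurableSet_Ioc
  have htop : ∫⁻ y in Ioc a x, liminf (fun n => ENNReal.ofReal (APT.riskAversion (U n) y)) atTop =
      ⊤ := by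
    have heq : EqOn (fun y => liminf (fun n => ENNReal.ofReal (APT.riskAversion (U n) y)) atTop)
        (fun _ => ⊤) (Ioc a x) := fun y hy =>
      (ENNReal.tendsto_ofReal_atTop.comp (hra y (ha.trans hy.1))).liminf_eq
    rw [setLIntegral_congr_fun measurableSet_Ioc heq]
    simp [hax]
  rw [htop, top_le_iff] at hfatou
  have hlim : Tendsto (fun n => ENNReal.ofReal
      (Real.log (deriv (U n) a) - Real.log (deriv (U n) x))) atTop (𝓝 ⊤) := by
    refine tendsto_of_le_liminf_of_limsup_le ?_ le_top
    simp only [fun n => (hU n).log_deriv_sub_log_deriv ha hax.le]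
    exact hfatou.ge
  have hlog : Tendsto (fun n => Real.log (deriv (U n) a) - Real.log (deriv (U n) x))
      atTop atTop := by
    rw [tendsto_atTop]
    intro C
    filter_upwards [ENNReal.tendsto_nhds_top_iff_nnreal.1 hlim C.toNNReal] with n hn
    have hn' : ENNReal.ofReal C < ENNReal.ofReal _ := hn
    exact (ENNReal.ofReal_lt_ofReal_iff'.1 hn').1.le
  refine (Real.tendsto_exp_atTop.comp hlog).congr fun n => ?_
  have h1 := (hU n).deriv_pos ha
  have h2 := (hU n).deriv_pos (ha.trans hax)
  rw [Function.comp_apply, ← Real.log_div h1.ne' h2.ne', Real.exp_log (div_pos h1 h2)]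

/-- Below `a` the tangent at `a` and `U a ≤ U x` apply, between `a` and `x` monotonicity, above `x`
the tangent at `x`. Losses are thus charged at the rate `U' a` and gains credited only at the rate
`U' x`. -/
theorem le_kinked_bound (hU : IsUtility U) {a x t : ℝ} (ha : 0 < a) (hax : a ≤ x) (ht : 0 < t) :
    U t ≤ U x - deriv U a * max (a - t) 0 + deriv U x * max (t - x) 0 := by
  have hmono := hU.strictMono.monotoneOn
  have hx : 0 < x := ha.trans_le hax
  rcases le_total t a with h1 | h1
  · rw [max_eq_left (by linarith), max_eq_right (by linarith)]
    have h2 := hU.le_tangent ha ht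
    have h3 := hmono ha hx hax
    linarith
  · rw [max_eq_right (by linarith : a - t ≤ 0)]
    rcases le_total t x with h2 | h2
    · rw [max_eq_right (by linarith)]
      have := hmono ht hx h2
      linarith
    · rw [max_eq_left (by linarith)]
      have := hU.le_tangent hx ht
      linarith

theorem tendsto_rightLim (hU : IsUtility U) :
    Tendsto (fun t : ℝ => (U t : EReal)) (𝓝[>] 0)
      (𝓝 (Function.rightLim (fun t : ℝ => (U t : EReal)) 0)) := by
  have hmono : MonotoneOn (fun t : ℝ => (U t : EReal)) (Ioi 0) := fun s hs t ht hst =>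
    EReal.coe_le_coe_iff.2 (hU.strictMono.monotoneOn hs ht hst)
  have h := hmono.tendsto_nhdsGT (OrderBot.bddBelow _)
  rwa [rightLim_eq_of_tendsto h]

theorem extendUtility_mono (hU : IsUtility U) : Monotone (APT.extendUtility U) := by
  intro s t hst
  unfold APT.extendUtility
  rcases lt_trichotomy s 0 with hs | hs | hs
  · simp [hs.not_gt, hs.ne]
  · subst hs
    rcases hst.eq_or_lt with rfl | ht
    · rfl
    · rw [if_neg (lt_irrefl _), if_pos rfl, if_pos ht]
      refine le_of_tendsto hU.tendsto_rightLim ?_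
      filter_upwards [Ioo_mem_nhdsGT ht] with r hr
      exact EReal.coe_le_coe_iff.2 (hU.strictMono.monotoneOn hr.1 ht hr.2.le)
  · rw [if_pos hs, if_pos (hs.trans_le hst)]
    exact EReal.coe_le_coe_iff.2 (hU.strictMono.monotoneOn hs (hs.trans_le hst) hst)

/-- Continuity of `φ` carries the bound over to the value at `0`, which is a right limit. -/
theorem extendUtility_le (hU : IsUtility U) {φ : ℝ → ℝ} (hφ : Continuous φ)
    (hle : ∀ t, 0 < t → U t ≤ φ t) (t : ℝ) : APT.extendUtility U t ≤ (φ t : EReal) := by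
  unfold APT.extendUtility
  split_ifs with h1 h2
  · exact EReal.coe_le_coe_iff.2 (hle t h1)
  · subst h2
    refine le_of_tendsto_of_tendsto hU.tendsto_rightLim
      ((continuous_coe_real_ereal.comp hφ).continuousWithinAt (s := Ioi 0)).tendsto ?_
    filter_upwards [self_mem_nhdsWithin] with s hs
    exact EReal.coe_le_coe_iff.2 (hle s hs)
  · exact bot_le

end IsUtility

/-! ### Expected utility with values in the extended reals. -/

section ExpectedUtility

variable {Ω : Type*} [MeasurableSpace Ω] {P : Measure Ω} {U : ℝ → ℝ} {Y Z : Ω → ℝ}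

theorem integral_eq_coe_lintegral_sub (hZ : Integrable Z P) :
    ((∫ ω, Z ω ∂P : ℝ) : EReal) =
      ((∫⁻ ω, ENNReal.ofReal (Z ω) ∂P : ENNReal) : EReal) -
        ((∫⁻ ω, ENNReal.ofReal (-Z ω) ∂P : ENNReal) : EReal) := by
  have h1 : ∫⁻ ω, ENNReal.ofReal (Z ω) ∂P ≠ ⊤ := hZ.lintegral_lt_top.ne
  have h2 : ∫⁻ ω, ENNReal.ofReal (-Z ω) ∂P ≠ ⊤ := hZ.neg.lintegral_lt_top.ne
  rw [integral_eq_lintegral_pos_part_sub_lintegral_neg_part hZ, EReal.coe_sub,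
    EReal.coe_ennreal_toReal h1, EReal.coe_ennreal_toReal h2]

theorem expUtility_le_integral (hZ : Integrable Z P)
    (hle : ∀ᵐ ω ∂P, APT.extendUtility U (Y ω) ≤ (Z ω : EReal)) :
    APT.expUtility P U Y ≤ ((∫ ω, Z ω ∂P : ℝ) : EReal) := by
  rw [integral_eq_coe_lintegral_sub hZ]
  refine EReal.sub_le_sub ?_ ?_ <;> rw [EReal.coe_ennreal_le_coe_ennreal_iff] <;>
    refine lintegral_mono_ae ?_ <;> filter_upwards [hle] with ω hω
  · exact EReal.toENNReal_le_toENNReal hω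
  · exact EReal.toENNReal_le_toENNReal (EReal.neg_le_neg_iff.2 hω)

theorem expUtilityPos_lt_top (hZ : Integrable Z P)
    (hle : ∀ᵐ ω ∂P, APT.extendUtility U (Y ω) ≤ (Z ω : EReal)) :
    APT.expUtilityPos P U Y < ⊤ := by
  refine lt_of_le_of_lt (lintegral_mono_ae ?_) hZ.lintegral_lt_top
  filter_upwards [hle] with ω hω using EReal.toENNReal_le_toENNReal hω

theorem IsUtility.expUtility_mono (hU : IsUtility U) (hle : ∀ᵐ ω ∂P, Y ω ≤ Z ω) :
    APT.expUtility P U Y ≤ APT.expUtility P U Z := by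
  refine EReal.sub_le_sub ?_ ?_ <;> rw [EReal.coe_ennreal_le_coe_ennreal_iff] <;>
    refine lintegral_mono_ae ?_ <;> filter_upwards [hle] with ω hω
  · exact EReal.toENNReal_le_toENNReal (hU.extendUtility_mono hω)
  · exact EReal.toENNReal_le_toENNReal (EReal.neg_le_neg_iff.2 (hU.extendUtility_mono hω))

theorem expUtility_const [IsProbabilityMeasure P] {x : ℝ} (hx : 0 < x) :
    APT.expUtility P U (fun _ => x) = (U x : EReal) := by
  have h := integral_eq_coe_lintegral_sub (P := P) (integrable_const (U x))
  rw [integral_const, probReal_univ, one_smul] at h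
  rw [h, APT.expUtility, APT.expUtilityPos, APT.expUtilityNeg]
  simp [APT.extendUtility, hx, ← EReal.coe_neg]

end ExpectedUtility

end Utility

/-! ### Independent factors and the comparison of `L¹` and `ℓ₂` norms. -/

noncomputable section

variable {Ω : Type*} [MeasurableSpace Ω]

/-- Independent centred random variables with unit variance. -/
structure IsFactorModel (P : Measure Ω) (ε : ℕ → Ω → ℝ) : Prop where
  measurable : ∀ i, Measurable (ε i)
  memLp_two : ∀ i, MemLp (ε i) 2 P
  indep : iIndepFun ε P
  mean : ∀ i, ∫ ω, ε i ω ∂P = 0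
  variance : ∀ i, ∫ ω, ε i ω ^ 2 ∂P = 1

namespace IsFactorModel

variable {P : Measure Ω} {ε : ℕ → Ω → ℝ} {b : ℕ → ℝ}

theorem orthonormal (H : IsFactorModel P ε) :
    Orthonormal ℝ fun i => ((H.memLp_two i).toLp : Lp ℝ 2 P) := by
  rw [orthonormal_iff_ite]
  intro i j
  have h1 : inner ℝ ((H.memLp_two i).toLp : Lp ℝ 2 P) (H.memLp_two j).toLp =
      ∫ ω, ε i ω * ε j ω ∂P := by
    rw [L2.inner_def]
    refine integral_congr_ae ?_
    filter_upwards [(H.memLp_two i).coeFn_toLp, (H.memLp_two j).coeFn_toLp] with ω h2 h3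
    simp only [h2, h3]
    simp [mul_comm]
  rw [h1]
  split_ifs with hij
  · subst hij
    simpa [sq] using H.variance i
  · rw [(H.indep.indepFun hij).integral_fun_mul_eq_mul_integral (H.memLp_two i).1
      (H.memLp_two j).1, H.mean i, zero_mul]

/-- The map `h ↦ ∑ h_i ε_i` as an isometry into `L²(P)`. -/
def isometry (H : IsFactorModel P ε) : APT.Ell2 →ₗᵢ[ℝ] Lp ℝ 2 P :=
  H.orthonormal.orthogonalFamily.linearIsometry

theorem hasSum_isometry (H : IsFactorModel P ε) (h : APT.Ell2) :
    HasSum (fun i => h i • ((H.memLp_two i).toLp : Lp ℝ 2 P)) (H.isometry h) := by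
  have := H.orthonormal.orthogonalFamily.hasSum_linearIsometry h
  simp only [LinearIsometry.toSpanSingleton_apply] at this
  exact this

/-- Finite combinations of the factors. -/
def partialSum (ε : ℕ → Ω → ℝ) (h : ℕ → ℝ) (n : ℕ) : Ω → ℝ :=
  fun ω => ∑ i ∈ Finset.range n, h i * ε i ω

theorem memLp_partialSum {p : ENNReal} (hε : ∀ i, MemLp (ε i) p P) (h : ℕ → ℝ) (n : ℕ) :
    MemLp (partialSum ε h n) p P :=
  memLp_finsetSum _ fun i _ => (hε i).const_mul (h i)

theorem toLp_partialSum (H : IsFactorModel P ε) (h : ℕ → ℝ) (n : ℕ) :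
    (memLp_partialSum H.memLp_two h n).toLp =
      ∑ i ∈ Finset.range n, h i • ((H.memLp_two i).toLp : Lp ℝ 2 P) := by
  induction n with
  | zero => simp; rfl
  | succ n ih =>
    rw [Finset.sum_range_succ, ← ih, ← MemLp.toLp_const_smul, ← MemLp.toLp_add]
    congr 1
    funext ω
    simp [partialSum, Finset.sum_range_succ]

theorem indepFun_partialSum (H : IsFactorModel P ε) (h : ℕ → ℝ) (n : ℕ) :
    IndepFun (partialSum ε h n) (ε n) P := by
  have h1 := H.indep.indepFun_finset (Finset.range n) {n} (by simp) H.measurable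
  have hψ : Measurable fun v : ({n} : Finset ℕ) → ℝ => v ⟨n, by simp⟩ := measurable_pi_apply _
  have h2 := h1.comp
    (φ := fun v : Finset.range n → ℝ => ∑ i : Finset.range n, h i * v i)
    (by fun_prop) hψ
  convert h2 using 1
  · funext ω
    simp only [partialSum, Function.comp]
    exact (Finset.sum_coe_sort (Finset.range n) fun i => h i * ε i ω).symm
  · rfl

theorem partialSum_succ {Ω : Type*} (ε : ℕ → Ω → ℝ) (h : ℕ → ℝ) (n : ℕ) (ω : Ω) :
    partialSum ε h (n + 1) ω = partialSum ε h n ω + h n * ε n ω := by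
  simp [partialSum, Finset.sum_range_succ]

theorem integral_partialSum_sq (H : IsFactorModel P ε) (h : ℕ → ℝ) (n : ℕ) :
    ∫ ω, partialSum ε h n ω ^ 2 ∂P = ∑ i ∈ Finset.range n, h i ^ 2 := by
  induction n with
  | zero => simp [partialSum]
  | succ n ih =>
    have hS := memLp_partialSum H.memLp_two h n
    have hmul : Integrable (fun ω => partialSum ε h n ω * ε n ω) P :=
      hS.integrable_mul (H.memLp_two n)
    have hzero : ∫ ω, partialSum ε h n ω * ε n ω ∂P = 0 := by
      rw [(H.indepFun_partialSum h n).integral_fun_mul_eq_mul_integral hS.1 (H.memLp_two n).1,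
        H.mean, mul_zero]
    have hexp : ∀ ω, partialSum ε h (n + 1) ω ^ 2 = partialSum ε h n ω ^ 2 +
        2 * h n * (partialSum ε h n ω * ε n ω) + h n ^ 2 * ε n ω ^ 2 := fun ω => by
      rw [partialSum_succ]
      ring
    have hmul' : Integrable (fun ω => 2 * h n * (partialSum ε h n ω * ε n ω)) P :=
      hmul.const_mul _
    have hadd : Integrable (fun ω => partialSum ε h n ω ^ 2 +
        2 * h n * (partialSum ε h n ω * ε n ω)) P := hS.integrable_sq.add hmul'
    simp_rw [hexp]
    rw [integral_add hadd ((H.memLp_two n).integrable_sq.const_mul _),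
      integral_add hS.integrable_sq hmul', integral_const_mul, integral_const_mul, ih, hzero, H.variance,
      Finset.sum_range_succ]
    ring

theorem integrable_abs_pow_three {f : Ω → ℝ} (hf : MemLp f 3 P) :
    Integrable (fun ω => |f ω| ^ 3) P := by
  have h : Integrable (fun ω => ‖f ω‖ ^ 3) P :=
    MemLp.integrable_norm_pow (by rwa [Nat.cast_ofNat]) three_ne_zero
  simpa only [Real.norm_eq_abs] using h

theorem integral_abs_le_of_integral_sq_le [IsProbabilityMeasure P] {f : Ω → ℝ} (hf : MemLp f 2 P) {B : ℝ} (hB : 0 < B)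
    (hle : ∫ ω, f ω ^ 2 ∂P ≤ B ^ 2) : ∫ ω, |f ω| ∂P ≤ B := by
  -- This integrates `(|f| - B) ^ 2 ≥ 0`.
  have h1 : ∫ ω, 2 * B * |f ω| ∂P ≤ ∫ ω, (f ω ^ 2 + B ^ 2) ∂P := by
    refine integral_mono ((hf.integrable (by norm_num)).abs.const_mul _)
      (hf.integrable_sq.add (integrable_const _)) fun ω => ?_
    have := sq_nonneg (|f ω| - B)
    rw [sub_sq, sq_abs] at this
    simp only
    linarith
  rw [integral_const_mul, integral_add hf.integrable_sq (integrable_const _), integral_const,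
    probReal_univ, one_smul] at h1
  by_contra! hcon
  nlinarith

theorem sum_sq_le_norm_sq (h : APT.Ell2) (n : ℕ) :
    ∑ i ∈ Finset.range n, h i ^ 2 ≤ ‖h‖ ^ 2 := by
  have := lp.sum_rpow_le_norm_rpow (p := 2) (by norm_num) h (Finset.range n)
  simpa using this

/-- Adding `h n * ε n` contributes nothing at first order by independence, at most `3 * h n ^ 2 * B`
at second order since `E|S| ≤ B`, and at most `h n ^ 2 * B * M` at third order since `|h n| ≤ B`. -/
theorem integral_abs_partialSum_pow_three_le [IsProbabilityMeasure P] (H : IsFactorModel P ε) {M : ℝ}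
    (h3 : ∀ i, MemLp (ε i) 3 P) (hM : ∀ i, ∫ ω, |ε i ω| ^ 3 ∂P ≤ M) {h : ℕ → ℝ} {B : ℝ}
    (hB : 0 < B) (hhB : ∀ n, ∑ i ∈ Finset.range n, h i ^ 2 ≤ B ^ 2) (n : ℕ) :
    ∫ ω, |partialSum ε h n ω| ^ 3 ∂P ≤ (3 + M) * B * ∑ i ∈ Finset.range n, h i ^ 2 := by
  have hM0 : 0 ≤ M := (integral_nonneg fun ω => by positivity).trans (hM 0)
  induction n with
  | zero => simp [partialSum]
  | succ n ih =>
    set S := partialSum ε h n with hSdef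
    have hS3 : MemLp S 3 P := memLp_partialSum h3 h n
    have hS2 : MemLp S 2 P := memLp_partialSum H.memLp_two h n
    have hS1 : Integrable S P := hS2.integrable (by norm_num)
    have hind := H.indepFun_partialSum h n
    have hi1 : IndepFun (fun ω => S ω * |S ω|) (ε n) P :=
      hind.comp (φ := fun s : ℝ => s * |s|) (ψ := id) (by fun_prop) measurable_id
    have hi2 : IndepFun (fun ω => |S ω|) (fun ω => ε n ω ^ 2) P :=
      hind.comp (φ := fun s : ℝ => |s|) (ψ := fun s : ℝ => s ^ 2) (by fun_prop) (by fun_prop)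
    have hSS : Integrable (fun ω => S ω * |S ω|) P := hS2.integrable_mul hS2.abs
    have hεi : Integrable (ε n) P := (H.memLp_two n).integrable (by norm_num)
    have hI1 : Integrable (fun ω => S ω * |S ω| * ε n ω) P := hi1.integrable_mul hSS hεi
    have hI2 : Integrable (fun ω => |S ω| * ε n ω ^ 2) P :=
      hi2.integrable_mul hS1.abs (H.memLp_two n).integrable_sq
    have hJ1 : Integrable (fun ω => |S ω| ^ 3 + 3 * h n * (S ω * |S ω| * ε n ω)) P :=
      (integrable_abs_pow_three hS3).add (hI1.const_mul _)
    have hJ2 : Integrable (fun ω => |S ω| ^ 3 + 3 * h n * (S ω * |S ω| * ε n ω) +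
        3 * h n ^ 2 * (|S ω| * ε n ω ^ 2)) P := hJ1.add (hI2.const_mul _)
    have he1 : ∫ ω, S ω * |S ω| * ε n ω ∂P = 0 := by
      rw [hi1.integral_fun_mul_eq_mul_integral hSS.1 hεi.1, H.mean, mul_zero]
    have he2 : ∫ ω, |S ω| * ε n ω ^ 2 ∂P = ∫ ω, |S ω| ∂P := by
      rw [hi2.integral_fun_mul_eq_mul_integral hS1.abs.1 (H.memLp_two n).integrable_sq.1,
        H.variance, mul_one]
    have habs : ∫ ω, |S ω| ∂P ≤ B := integral_abs_le_of_integral_sq_le hS2 hB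
      ((H.integral_partialSum_sq h n).trans_le (hhB n))
    have hhn : |h n| ≤ B := by
      have h1 := hhB (n + 1)
      rw [Finset.sum_range_succ] at h1
      have h2 : 0 ≤ ∑ i ∈ Finset.range n, h i ^ 2 := Finset.sum_nonneg fun i _ => sq_nonneg _
      exact abs_le_of_sq_le_sq (by linarith) hB.le
    have hbound : ∫ ω, |partialSum ε h (n + 1) ω| ^ 3 ∂P ≤
        ∫ ω, (|S ω| ^ 3 + 3 * h n * (S ω * |S ω| * ε n ω) +
          3 * h n ^ 2 * (|S ω| * ε n ω ^ 2) + |h n| ^ 3 * |ε n ω| ^ 3) ∂P := by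
      refine integral_mono (integrable_abs_pow_three (memLp_partialSum h3 h (n + 1)))
        (hJ2.add ((integrable_abs_pow_three (h3 n)).const_mul _)) fun ω => ?_
      have h1 := abs_add_pow_three_le (S ω) (h n * ε n ω)
      rw [abs_mul, mul_pow] at h1
      simp only [partialSum_succ]
      refine h1.trans (le_of_eq ?_)
      ring
    rw [integral_add hJ2 ((integrable_abs_pow_three (h3 n)).const_mul _),
      integral_add hJ1 (hI2.const_mul _),
      integral_add (integrable_abs_pow_three hS3) (hI1.const_mul _), integral_const_mul,
      integral_const_mul, integral_const_mul, he1, he2] at hbound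
    rw [Finset.sum_range_succ, mul_add]
    have hA : h n ^ 2 * ∫ ω, |S ω| ∂P ≤ h n ^ 2 * B := by gcongr
    have hC : |h n| ^ 3 * ∫ ω, |ε n ω| ^ 3 ∂P ≤ h n ^ 2 * B * M := by
      rw [pow_succ |h n| 2, sq_abs]
      have := hM n
      gcongr
    linarith

/-- The `L¹` norm of `∑ h_i ε_i` is bounded below by a multiple of the `ℓ₂` norm of `h` when the
third moments are bounded. -/
theorem norm_le_integral_abs_isometry [IsProbabilityMeasure P] (H : IsFactorModel P ε) {M : ℝ}
    (h3 : ∀ i, MemLp (ε i) 3 P) (hM : ∀ i, ∫ ω, |ε i ω| ^ 3 ∂P ≤ M) (h : APT.Ell2) :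
    ‖h‖ ≤ (3 + M) * ∫ ω, |H.isometry h ω| ∂P := by
  have hM0 : 0 ≤ M := (integral_nonneg fun ω => by positivity).trans (hM 0)
  rcases (norm_nonneg h).eq_or_lt with h0 | hB
  · rw [← h0]
    exact mul_nonneg (by linarith) (integral_nonneg fun ω => abs_nonneg _)
  set B := ‖h‖ with hBdef
  have hfin : ∀ n, ∑ i ∈ Finset.range n, h i ^ 2 ≤
      (3 + M) * B * ∫ ω, |partialSum ε h n ω| ∂P := by
    intro n
    set S := partialSum ε h n with hSdef
    have hS3 : MemLp S 3 P := memLp_partialSum h3 h n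
    have hS2 : MemLp S 2 P := memLp_partialSum H.memLp_two h n
    have hS1 : Integrable S P := hS2.integrable (by norm_num)
    set l := (3 + M) * B with hl
    have hlpos : 0 < l := by positivity
    -- This integrates `|S| * (l - |S|) ^ 2 ≥ 0`. For `l = (3 + M) * B` the third moment is at most
    -- `l * E S ^ 2`, which absorbs half of the left side.
    have h1 : ∫ ω, 2 * l * S ω ^ 2 ∂P ≤ ∫ ω, (l ^ 2 * |S ω| + |S ω| ^ 3) ∂P := by
      refine integral_mono (hS2.integrable_sq.const_mul _)
        ((hS1.abs.const_mul _).add (integrable_abs_pow_three hS3)) fun ω => ?_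
      have h2 := mul_nonneg (abs_nonneg (S ω)) (sq_nonneg (l - |S ω|))
      have h3 := sq_abs (S ω)
      simp only
      rw [← h3]
      nlinarith
    rw [integral_const_mul, integral_add (hS1.abs.const_mul _) (integrable_abs_pow_three hS3), integral_const_mul,
      H.integral_partialSum_sq] at h1
    have h2 := H.integral_abs_partialSum_pow_three_le h3 hM hB (sum_sq_le_norm_sq h) n
    rw [← hl, ← hSdef] at h2
    have h4 : l * ∑ i ∈ Finset.range n, h i ^ 2 ≤ l * (l * ∫ ω, |S ω| ∂P) := by linarith
    exact le_of_mul_le_mul_left h4 hlpos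
  set one : Lp ℝ 2 P := (memLp_const (1 : ℝ)).toLp with hone
  -- As an inner product with `1`, the `L¹` norm is visibly continuous on `L²`.
  have hinner : ∀ f : Lp ℝ 2 P, inner ℝ one |f| = ∫ ω, |f ω| ∂P := by
    intro f
    rw [L2.inner_def]
    refine integral_congr_ae ?_
    filter_upwards [(memLp_const (1 : ℝ)).coeFn_toLp (p := 2) (μ := P), Lp.coeFn_abs f] with ω h1 h2
    simp [hone, h2]
  have hlim : Tendsto (fun n => ∫ ω, |partialSum ε h n ω| ∂P) atTop
      (𝓝 (∫ ω, |H.isometry h ω| ∂P)) := by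
    rw [← hinner]
    have hc : Continuous fun f : Lp ℝ 2 P => inner ℝ one |f| :=
      continuous_const.inner (continuous_id.sup continuous_neg)
    refine ((hc.tendsto _).comp (H.hasSum_isometry h).tendsto_sum_nat).congr fun n => ?_
    rw [Function.comp_apply, ← H.toLp_partialSum, hinner]
    refine integral_congr_ae ?_
    filter_upwards [(memLp_partialSum H.memLp_two (h : ℕ → ℝ) n).coeFn_toLp] with ω hω
    rw [hω]
  have hnorm : Tendsto (fun n => ∑ i ∈ Finset.range n, h i ^ 2) atTop (𝓝 (B ^ 2)) := by
    have h1 := lp.hasSum_norm (p := 2) (by norm_num) h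
    simpa using h1.tendsto_sum_nat
  have hfinal := le_of_tendsto_of_tendsto' hnorm (hlim.const_mul ((3 + M) * B)) hfin
  rw [sq] at hfinal
  refine le_of_mul_le_mul_left (hfinal.trans (le_of_eq ?_)) hB
  ring

end IsFactorModel

end

/-! ### The gain operator and absence of arbitrage. -/

noncomputable section

variable {Ω : Type*} [MeasurableSpace Ω]

namespace IsFactorModel

variable {P : Measure Ω} [IsProbabilityMeasure P] {ε : ℕ → Ω → ℝ} {b : ℕ → ℝ}

/-- The map `h ↦ ∑ h_i (ε_i - b_i)` as a continuous linear map into `L²(P)`. -/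
def gainOp (H : IsFactorModel P ε) (hb : Memℓp b 2) : APT.Ell2 →L[ℝ] Lp ℝ 2 P :=
  H.isometry.toContinuousLinearMap -
    (innerSL ℝ (⟨b, hb⟩ : APT.Ell2)).smulRight ((memLp_const (1 : ℝ)).toLp : Lp ℝ 2 P)

theorem gainOp_apply (H : IsFactorModel P ε) (hb : Memℓp b 2) (h : APT.Ell2) :
    H.gainOp hb h = H.isometry h -
      inner ℝ (⟨b, hb⟩ : APT.Ell2) h • ((memLp_const (1 : ℝ)).toLp : Lp ℝ 2 P) := rfl

theorem gainOp_ae_eq (H : IsFactorModel P ε) (hb : Memℓp b 2) (h : APT.Ell2) :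
    H.gainOp hb h =ᵐ[P] fun ω => H.isometry h ω - inner ℝ (⟨b, hb⟩ : APT.Ell2) h := by
  rw [gainOp_apply]
  filter_upwards [Lp.coeFn_sub (H.isometry h)
    (inner ℝ (⟨b, hb⟩ : APT.Ell2) h • ((memLp_const (1 : ℝ)).toLp : Lp ℝ 2 P)),
    Lp.coeFn_smul (inner ℝ (⟨b, hb⟩ : APT.Ell2) h) ((memLp_const (1 : ℝ)).toLp : Lp ℝ 2 P),
    (memLp_const (1 : ℝ)).coeFn_toLp (p := 2) (μ := P)] with ω h1 h2 h3
  rw [h1, Pi.sub_apply, h2, Pi.smul_apply, h3, smul_eq_mul, mul_one]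

theorem memLp_partialGain (H : IsFactorModel P ε) (b : ℕ → ℝ) (h : APT.Ell2) (n : ℕ) :
    MemLp (APT.partialGain ε b h n) 2 P :=
  memLp_finsetSum _ fun i _ => ((H.memLp_two i).sub (memLp_const _)).const_mul (h i)

theorem toLp_partialGain (H : IsFactorModel P ε) (b : ℕ → ℝ) (h : APT.Ell2) (n : ℕ) :
    (H.memLp_partialGain b h n).toLp =
      ∑ i ∈ Finset.range n, h i • ((H.memLp_two i).toLp : Lp ℝ 2 P) -
        (∑ i ∈ Finset.range n, h i * b i) • ((memLp_const (1 : ℝ)).toLp : Lp ℝ 2 P) := by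
  rw [← H.toLp_partialSum, ← MemLp.toLp_const_smul, ← MemLp.toLp_sub]
  congr 1
  funext ω
  simp [APT.partialGain, partialSum, mul_sub]

theorem tendsto_toLp_partialGain (H : IsFactorModel P ε) (hb : Memℓp b 2) (h : APT.Ell2) :
    Tendsto (fun n => (H.memLp_partialGain b h n).toLp) atTop (𝓝 (H.gainOp hb h)) := by
  rw [funext (H.toLp_partialGain b h), gainOp_apply]
  have hin : HasSum (fun i => h i * b i) (inner ℝ (⟨b, hb⟩ : APT.Ell2) h) := by
    have := lp.hasSum_inner (𝕜 := ℝ) (⟨b, hb⟩ : APT.Ell2) h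
    simpa using this
  exact (H.hasSum_isometry h).tendsto_sum_nat.sub (hin.tendsto_sum_nat.smul_const _)

theorem isGain_gain (H : IsFactorModel P ε) (hb : Memℓp b 2) (h : APT.Ell2) :
    APT.IsGain P ε b h (APT.gain P ε b h) :=
  APT.isGain_gain H.memLp_two H.indep H.mean H.variance hb h

theorem gain_ae_eq_gainOp (H : IsFactorModel P ε) (hb : Memℓp b 2) (h : APT.Ell2) :
    APT.gain P ε b h =ᵐ[P] H.gainOp hb h := by
  obtain ⟨h1, h2⟩ := H.isGain_gain hb h
  have h3 := (Lp.tendsto_Lp_iff_tendsto_eLpNorm'' _ (H.memLp_partialGain b h) _ h1).2 h2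
  rw [← tendsto_nhds_unique h3 (H.tendsto_toLp_partialGain hb h)]
  exact h1.coeFn_toLp.symm

theorem integral_isometry (H : IsFactorModel P ε) (h : APT.Ell2) :
    ∫ ω, H.isometry h ω ∂P = 0 := by
  set one : Lp ℝ 2 P := (memLp_const (1 : ℝ)).toLp with hone
  have hinner : ∀ f : Lp ℝ 2 P, inner ℝ one f = ∫ ω, f ω ∂P := by
    intro f
    rw [L2.inner_def]
    refine integral_congr_ae ?_
    filter_upwards [(memLp_const (1 : ℝ)).coeFn_toLp (p := 2) (μ := P)] with ω h1
    rw [h1]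
    simp
  have h1 := (innerSL ℝ one).hasSum (H.hasSum_isometry h)
  rw [← hinner, ← innerSL_apply_apply ℝ, ← h1.tsum_eq]
  refine (tsum_congr fun i => ?_).trans tsum_zero
  rw [map_smul, innerSL_apply_apply, hinner, integral_congr_ae (H.memLp_two i).coeFn_toLp,
    H.mean, smul_zero]

theorem integrable_gain (H : IsFactorModel P ε) (hb : Memℓp b 2) (h : APT.Ell2) :
    Integrable (APT.gain P ε b h) P :=
  (H.isGain_gain hb h).1.integrable (by norm_num)

theorem integral_gain (H : IsFactorModel P ε) (hb : Memℓp b 2) (h : APT.Ell2) :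
    ∫ ω, APT.gain P ε b h ω ∂P = -inner ℝ (⟨b, hb⟩ : APT.Ell2) h := by
  rw [integral_congr_ae ((H.gain_ae_eq_gainOp hb h).trans (H.gainOp_ae_eq hb h)),
    integral_sub ((Lp.memLp _).integrable (by norm_num)) (integrable_const _),
    H.integral_isometry, integral_const, probReal_univ, one_smul, zero_sub]

theorem gain_zero (H : IsFactorModel P ε) (hb : Memℓp b 2) : APT.gain P ε b 0 =ᵐ[P] 0 := by
  refine (H.gain_ae_eq_gainOp hb 0).trans ?_
  rw [map_zero]
  exact Lp.coeFn_zero _ _ _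

theorem gain_add (H : IsFactorModel P ε) (hb : Memℓp b 2) (g h : APT.Ell2) :
    APT.gain P ε b (g + h) =ᵐ[P] fun ω => APT.gain P ε b g ω + APT.gain P ε b h ω := by
  have h1 := H.gain_ae_eq_gainOp hb (g + h)
  rw [map_add] at h1
  filter_upwards [h1, Lp.coeFn_add (H.gainOp hb g) (H.gainOp hb h), H.gain_ae_eq_gainOp hb g,
    H.gain_ae_eq_gainOp hb h] with ω h1 h2 h3 h4
  rw [h1, h2, Pi.add_apply, h3, h4]

theorem gain_smul (H : IsFactorModel P ε) (hb : Memℓp b 2) (c : ℝ) (h : APT.Ell2) :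
    APT.gain P ε b (c • h) =ᵐ[P] fun ω => c * APT.gain P ε b h ω := by
  have h1 := H.gain_ae_eq_gainOp hb (c • h)
  rw [map_smul] at h1
  filter_upwards [h1, Lp.coeFn_smul c (H.gainOp hb h), H.gain_ae_eq_gainOp hb h] with ω h1 h2 h3
  rw [h1, h2, Pi.smul_apply, h3, smul_eq_mul]

/-- If each factor may end up on either side of `b_i`, then a nonzero strategy may lose money. -/
theorem eq_zero_of_gain_nonneg (H : IsFactorModel P ε) (hb : Memℓp b 2)
    (hpos : ∀ i, 0 < P {ω | b i < ε i ω}) (hneg : ∀ i, 0 < P {ω | ε i ω < b i})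
    {h : APT.Ell2} (hh : ∀ᵐ ω ∂P, 0 ≤ APT.gain P ε b h ω) : h = 0 := by
  by_contra hne
  obtain ⟨k, hk⟩ : ∃ k, h k ≠ 0 := by
    by_contra! hall
    exact hne (lp.ext (funext hall))
  set Z : ℕ → Ω → ℝ := fun i ω => h i * (ε i ω - b i) with hZ
  have hZm : ∀ i, Measurable (Z i) := fun i => ((H.measurable i).sub_const _).const_mul _
  have hZi : iIndepFun Z P :=
    H.indep.comp (fun i s => h i * (s - b i)) fun i => by fun_prop
  have hZneg : ∀ i, h i ≠ 0 → 0 < P {ω | Z i ω < 0} := by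
    intro i hi
    rcases lt_or_gt_of_ne hi with hi | hi
    · refine (hpos i).trans_le (measure_mono fun ω hω => ?_)
      exact mul_neg_of_neg_of_pos hi (sub_pos.2 hω)
    · refine (hneg i).trans_le (measure_mono fun ω hω => ?_)
      exact mul_neg_of_pos_of_neg hi (sub_neg.2 hω)
  have hZnonpos : ∀ i, 0 < P {ω | Z i ω ≤ 0} := by
    intro i
    by_cases hi : h i = 0
    · simp [hZ, hi]
    · exact (hZneg i hi).trans_le (measure_mono fun ω (hω : Z i ω < 0) => hω.le)
  obtain ⟨δ, hδ, hδP⟩ : ∃ δ > 0, 0 < P {ω | Z k ω ≤ -δ} := by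
    have hU : {ω | Z k ω < 0} ⊆ ⋃ n : ℕ, {ω | Z k ω ≤ -(1 / ((n : ℝ) + 1))} := by
      intro ω (hω : Z k ω < 0)
      obtain ⟨n, hn⟩ := exists_nat_one_div_lt (neg_pos.2 hω)
      exact mem_iUnion.2 ⟨n, by rw [mem_ofPred]; linarith⟩
    obtain ⟨n, hn⟩ := exists_measure_pos_of_not_measure_iUnion_null
      ((hZneg k hk).trans_le (measure_mono hU)).ne'
    exact ⟨_, by positivity, hn⟩
  set X := APT.gain P ε b h with hX
  set S := APT.partialGain ε b h with hS
  obtain ⟨hX2, hXlim⟩ := H.isGain_gain hb h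
  have hTIM : TendstoInMeasure P S atTop X :=
    tendstoInMeasure_of_tendsto_eLpNorm (by norm_num)
      (fun n => (H.memLp_partialGain b h n).1) hX2.1 hXlim
  set q : ℕ → ℝ := fun n => P.real {ω | δ / 4 ≤ ‖S n ω - X ω‖} with hq
  have hq0 : Tendsto q atTop (𝓝 0) := by
    have := tendstoInMeasure_iff_norm.1 hTIM (δ / 4) (by positivity)
    exact (ENNReal.tendsto_toReal ENNReal.zero_ne_top).comp this
  obtain ⟨N₀, hN₀⟩ := eventually_atTop.1 (hq0.eventually (ge_mem_nhds (show (0 : ℝ) < 1 / 4 by norm_num)))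
  -- `N` is large enough to include the factor `k` and to bring every later partial sum within `δ /
  -- 4` of `X` with probability at least `3 / 4`.
  set N := max N₀ (k + 1) with hN
  have hkN : k ∈ Finset.range N := Finset.mem_range.2 (by omega)
  set s : ℕ → Set ℝ := fun i => Iic (if i = k then -δ else 0) with hs
  set A : Set Ω := ⋂ i ∈ Finset.range N, Z i ⁻¹' s i with hA
  have hPA : 0 < P.real A := by
    rw [measureReal_def, hZi.measure_inter_preimage_eq_mul _ fun i _ => measurableSet_Iic,
      ENNReal.toReal_prod]
    refine Finset.prod_pos fun i _ => ENNReal.toReal_pos ?_ (measure_ne_top _ _)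
    by_cases hi : i = k
    · subst hi
      simpa [hs, preimage] using hδP.ne'
    · simpa [hs, preimage, hi] using (hZnonpos i).ne'
  have hAS : ∀ ω ∈ A, S N ω ≤ -δ := by
    intro ω hω
    have h1 : S N ω ≤ ∑ i ∈ Finset.range N, if i = k then -δ else 0 :=
      Finset.sum_le_sum fun i hi => (mem_iInter₂.1 hω i hi : _)
    rwa [Finset.sum_ite_eq' (Finset.range N) k, if_pos hkN] at h1
  -- The block sum `T` is independent of `A` and below `δ / 2` with probability at least `1 / 2`. On
  -- `A ∩ {T < δ / 2}` the partial sum `S M` is at most `-δ / 2` although `X ≥ 0`, so `S M` cannot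
  -- converge to `X` in probability.
  have hkey : ∀ M, N ≤ M → P.real A * (1 / 2) ≤ q M := by
    intro M hM
    set T : Ω → ℝ := fun ω => ∑ i ∈ Finset.Ico N M, Z i ω with hT
    have hSM : ∀ ω, S M ω = S N ω + T ω := fun ω =>
      (Finset.sum_range_add_sum_Ico (fun i => Z i ω) hM).symm
    have hprod : P.real (A ∩ {ω | T ω < δ / 2}) = P.real A * P.real {ω | T ω < δ / 2} := by
      have hind := hZi.indepFun_finset (Finset.range N) (Finset.Ico N M)
        (by
          rw [Finset.disjoint_left]
          intro i hi hi'
          rw [Finset.mem_range] at hi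
          rw [Finset.mem_Ico] at hi'
          omega) hZm
      have h1 := hind.measure_inter_preimage_eq_mul
        (⋂ i : Finset.range N, (fun v : Finset.range N → ℝ => v i) ⁻¹' s i)
        ((fun v : Finset.Ico N M → ℝ => ∑ i, v i) ⁻¹' Iio (δ / 2))
        (MeasurableSet.iInter fun i => measurable_pi_apply i measurableSet_Iic)
        ((Finset.measurable_sum _ fun i _ => measurable_pi_apply i) measurableSet_Iio)
      have e1 : (fun ω (i : Finset.range N) => Z i ω) ⁻¹'
          (⋂ i : Finset.range N, (fun v : Finset.range N → ℝ => v i) ⁻¹' s i) = A := by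
        ext ω
        simp [hA]
      have e2 : (fun ω (i : Finset.Ico N M) => Z i ω) ⁻¹'
          ((fun v : Finset.Ico N M → ℝ => ∑ i, v i) ⁻¹' Iio (δ / 2)) = {ω | T ω < δ / 2} := by
        ext ω
        simp only [mem_preimage, mem_Iio, mem_ofPred, hT]
        rw [Finset.sum_coe_sort (Finset.Ico N M) fun i => Z i ω]
      rw [e1, e2] at h1
      rw [measureReal_def, h1, ENNReal.toReal_mul]
      rfl
    have hhalf : 1 / 2 ≤ P.real {ω | T ω < δ / 2} := by
      have hcov : (univ : Set Ω) ⊆ {ω | T ω < δ / 2} ∪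
          ({ω | δ / 4 ≤ ‖S M ω - X ω‖} ∪ {ω | δ / 4 ≤ ‖S N ω - X ω‖}) := by
        intro ω _
        by_contra hcon
        simp only [mem_union, mem_ofPred, not_or, not_lt, not_le, Real.norm_eq_abs] at hcon
        obtain ⟨h1, h2, h3⟩ := hcon
        have := hSM ω
        rw [abs_lt] at h2 h3
        linarith [h2.2, h3.1]
      have h1 := measureReal_mono (μ := P) hcov
      rw [probReal_univ] at h1
      have h2 := hN₀ M ((le_max_left _ _).trans hM)
      have h3 := hN₀ N (le_max_left _ _)
      have h4 := measureReal_union_le (μ := P) {ω | T ω < δ / 2}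
        ({ω | δ / 4 ≤ ‖S M ω - X ω‖} ∪ {ω | δ / 4 ≤ ‖S N ω - X ω‖})
      have h5 := measureReal_union_le (μ := P)
        {ω | δ / 4 ≤ ‖S M ω - X ω‖} {ω | δ / 4 ≤ ‖S N ω - X ω‖}
      simp only [hq] at h2 h3
      linarith
    have hle : P.real (A ∩ {ω | T ω < δ / 2}) ≤ q M := by
      refine ENNReal.toReal_mono (measure_ne_top _ _) (measure_mono_ae ?_)
      filter_upwards [hh] with ω hω hωA
      have h1 := hAS ω hωA.1
      have h2 : T ω < δ / 2 := hωA.2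
      have h3 := hSM ω
      change δ / 4 ≤ ‖S M ω - X ω‖
      rw [Real.norm_eq_abs]
      refine le_trans ?_ (neg_le_abs _)
      linarith
    calc P.real A * (1 / 2) ≤ P.real A * P.real {ω | T ω < δ / 2} := by gcongr
      _ ≤ q M := hprod ▸ hle
  have := ge_of_tendsto hq0 (eventually_atTop.2 ⟨N, hkey⟩)
  linarith

theorem nonneg_of_neg_le_gain (H : IsFactorModel P ε) (hb : Memℓp b 2)
    (hpos : ∀ i, 0 < P {ω | b i < ε i ω}) (hneg : ∀ i, 0 < P {ω | ε i ω < b i})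
    {h : APT.Ell2} {y : ℝ} (hh : ∀ᵐ ω ∂P, -y ≤ APT.gain P ε b h ω) : 0 ≤ y := by
  by_contra! hy
  have h0 : h = 0 := H.eq_zero_of_gain_nonneg hb hpos hneg (by
    filter_upwards [hh] with ω hω
    linarith)
  subst h0
  have hF : ∀ᵐ _ω ∂P, False := by
    filter_upwards [hh, H.gain_zero hb] with ω h1 h2
    rw [h2, Pi.zero_apply] at h1
    linarith
  exact hF.exists.elim fun _ h => h

/-! ### The shortfall functional and boundedness of strategies with bounded losses. -/

/-- The `L²` distance of the gain of `h` to the random variables dominating `D`. -/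
def shortfall (H : IsFactorModel P ε) (hb : Memℓp b 2) (D : Lp ℝ 2 P) (h : APT.Ell2) : ℝ :=
  ‖(D - H.gainOp hb h) ⊔ 0‖

theorem continuous_shortfall (H : IsFactorModel P ε) (hb : Memℓp b 2) (D : Lp ℝ 2 P) :
    Continuous (H.shortfall hb D) :=
  ((continuous_const.sub (H.gainOp hb).continuous).sup continuous_const).norm

/-- The positive part is sublinear, the gain is linear, and the `L²` norm is monotone on nonnegative
functions. -/
theorem convexOn_shortfall (H : IsFactorModel P ε) (hb : Memℓp b 2) (D : Lp ℝ 2 P) :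
    ConvexOn ℝ univ (H.shortfall hb D) := by
  refine ⟨convex_univ, fun g _ h _ s t hs ht hst => ?_⟩
  set u := D - H.gainOp hb g with hu
  set v := D - H.gainOp hb h with hv
  have hcomb : D - H.gainOp hb (s • g + t • h) = s • u + t • v := by
    rw [map_add, map_smul, map_smul, hu, hv, smul_sub, smul_sub]
    nth_rewrite 1 [← one_smul ℝ D]
    rw [← hst, add_smul]
    abel
  have hle : ‖(s • u + t • v) ⊔ 0‖ ≤ ‖s • (u ⊔ 0) + t • (v ⊔ 0)‖ := by
    refine Lp.norm_le_norm_of_ae_le ?_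
    filter_upwards [Lp.coeFn_sup (s • u + t • v) 0, Lp.coeFn_add (s • u) (t • v),
      Lp.coeFn_smul s u, Lp.coeFn_smul t v, Lp.coeFn_zero ℝ 2 P,
      Lp.coeFn_add (s • (u ⊔ 0)) (t • (v ⊔ 0)), Lp.coeFn_smul s (u ⊔ 0),
      Lp.coeFn_smul t (v ⊔ 0), Lp.coeFn_sup u 0, Lp.coeFn_sup v 0]
      with ω h1 h2 h3 h4 h5 h6 h7 h8 h9 h10
    rw [h1, Pi.sup_apply, h2, Pi.add_apply, h3, h4, h6, Pi.add_apply, h7, h8]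
    simp only [Pi.smul_apply, smul_eq_mul]
    rw [h9, h10]
    simp only [Pi.sup_apply]
    rw [h5, Pi.zero_apply]
    have e1 : s * u ω ≤ s * (u ω ⊔ 0) := mul_le_mul_of_nonneg_left le_sup_left hs
    have e2 : t * v ω ≤ t * (v ω ⊔ 0) := mul_le_mul_of_nonneg_left le_sup_left ht
    have e3 : 0 ≤ s * (u ω ⊔ 0) := mul_nonneg hs le_sup_right
    have e4 : 0 ≤ t * (v ω ⊔ 0) := mul_nonneg ht le_sup_right
    rw [Real.norm_of_nonneg le_sup_right, Real.norm_of_nonneg (by linarith)]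
    exact sup_le (by linarith) (by linarith)
  change ‖(D - H.gainOp hb (s • g + t • h)) ⊔ 0‖ ≤ s * ‖u ⊔ 0‖ + t * ‖v ⊔ 0‖
  rw [hcomb]
  refine (hle.trans (norm_add_le _ _)).trans (le_of_eq ?_)
  rw [norm_smul, norm_smul, Real.norm_of_nonneg hs, Real.norm_of_nonneg ht]

theorem shortfall_ae_eq (H : IsFactorModel P ε) (hb : Memℓp b 2) (D : Lp ℝ 2 P)
    (h : APT.Ell2) :
    ⇑((D - H.gainOp hb h) ⊔ 0) =ᵐ[P] fun ω => max (D ω - APT.gain P ε b h ω) 0 := by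
  filter_upwards [Lp.coeFn_sup (D - H.gainOp hb h) 0, Lp.coeFn_sub D (H.gainOp hb h),
    Lp.coeFn_zero ℝ 2 P, H.gain_ae_eq_gainOp hb h] with ω h1 h2 h3 h4
  rw [h1, Pi.sup_apply, h2, h3, h4, Pi.sub_apply, Pi.zero_apply]

theorem shortfall_eq_zero_iff (H : IsFactorModel P ε) (hb : Memℓp b 2) (D : Lp ℝ 2 P)
    (h : APT.Ell2) : H.shortfall hb D h = 0 ↔ ∀ᵐ ω ∂P, D ω ≤ APT.gain P ε b h ω := by
  rw [shortfall, norm_eq_zero, Lp.eq_zero_iff_ae_eq_zero]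
  constructor <;> intro hle <;> filter_upwards [hle, H.shortfall_ae_eq hb D h] with ω h1 h2
  · rw [h1, Pi.zero_apply] at h2
    have := le_max_left (D ω - APT.gain P ε b h ω) 0
    linarith
  · rw [h2, Pi.zero_apply]
    exact max_eq_right (by linarith)

theorem shortfall_nonneg (H : IsFactorModel P ε) (hb : Memℓp b 2) (D : Lp ℝ 2 P)
    (h : APT.Ell2) : 0 ≤ H.shortfall hb D h := norm_nonneg _

theorem shortfall_sq (H : IsFactorModel P ε) (hb : Memℓp b 2) (D : Lp ℝ 2 P)
    (h : APT.Ell2) : H.shortfall hb D h ^ 2 =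
      ∫ ω, max (D ω - APT.gain P ε b h ω) 0 ^ 2 ∂P := by
  rw [shortfall, ← real_inner_self_eq_norm_sq, L2.inner_def]
  refine integral_congr_ae ?_
  filter_upwards [H.shortfall_ae_eq hb D h] with ω hω
  rw [hω, real_inner_self_eq_norm_sq, Real.norm_eq_abs, sq_abs]

/-- Over a bounded closed convex set of strategies none of which superhedges `D`, the shortfall is
bounded away from zero. -/
theorem exists_pos_le_shortfall (H : IsFactorModel P ε) (hb : Memℓp b 2) (D : Lp ℝ 2 P)
    {K : Set APT.Ell2} (hclosed : IsClosed K) (hconv : Convex ℝ K) (hbdd : Bornology.IsBounded K)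
    (hK : ∀ h ∈ K, ¬ ∀ᵐ ω ∂P, D ω ≤ APT.gain P ε b h ω) :
    ∃ m > 0, ∀ h ∈ K, m ≤ H.shortfall hb D h :=
  exists_pos_le_of_continuous_convexOn hclosed hconv hbdd (H.continuous_shortfall hb D)
    (H.convexOn_shortfall hb D) fun h hh =>
      (H.shortfall_nonneg hb D h).lt_of_ne' fun h0 =>
        hK h hh ((H.shortfall_eq_zero_iff hb D h).1 h0)

theorem isClosed_setOf_le_gain (H : IsFactorModel P ε) (hb : Memℓp b 2) (D : Lp ℝ 2 P) :
    IsClosed {h | ∀ᵐ ω ∂P, D ω ≤ APT.gain P ε b h ω} := by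
  simp only [← H.shortfall_eq_zero_iff hb D]
  exact isClosed_eq (H.continuous_shortfall hb D) continuous_const

theorem convex_setOf_le_gain (H : IsFactorModel P ε) (hb : Memℓp b 2) (D : Lp ℝ 2 P) :
    Convex ℝ {h | ∀ᵐ ω ∂P, D ω ≤ APT.gain P ε b h ω} := by
  have h1 := (H.convexOn_shortfall hb D).convex_le 0
  convert h1 using 1
  ext h
  simp only [mem_ofPred, mem_univ, true_and, ← H.shortfall_eq_zero_iff hb D]
  exact ⟨fun h => h.le, fun h' => le_antisymm h' (H.shortfall_nonneg hb D h)⟩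

/-- The strategies whose losses do not exceed a given bound form a bounded set. -/
theorem exists_norm_le_of_neg_le_gain (H : IsFactorModel P ε) (hb : Memℓp b 2)
    (hpos : ∀ i, 0 < P {ω | b i < ε i ω}) (hneg : ∀ i, 0 < P {ω | ε i ω < b i})
    {M : ℝ} (h3 : ∀ i, MemLp (ε i) 3 P) (hM : ∀ i, ∫ ω, |ε i ω| ^ 3 ∂P ≤ M) (y : ℝ) :
    ∃ R, ∀ h : APT.Ell2, (∀ᵐ ω ∂P, -y ≤ APT.gain P ε b h ω) → ‖h‖ ≤ R := by
  have hM0 : 0 ≤ M := (integral_nonneg fun ω => by positivity).trans (hM 0)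
  set β : APT.Ell2 := ⟨b, hb⟩ with hβ
  set C := 3 + M with hC
  have hCpos : 0 < C := by positivity
  -- Write `X` for the gain of `g`. From `|X| ≤ X + 2 * η` follows `E|X| ≤ -⟨β, g⟩ + 2 * η`. Since
  -- `∑ g_i ε_i = X + ⟨β, g⟩` and `|⟨β, g⟩| = |E X| ≤ E|X|`, its `L¹` norm is at most `2 * E|X|`,
  -- and it is at least `1 / C`.
  have hβle : ∀ (g : APT.Ell2) (η : ℝ), ‖g‖ = 1 → 0 ≤ η →
      (∀ᵐ ω ∂P, -η ≤ APT.gain P ε b g ω) → 1 / C ≤ -(2 * inner ℝ β g) + 4 * η := by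
    intro g η hg hη hgain
    have h1 := H.norm_le_integral_abs_isometry h3 hM g
    rw [hg, ← hC, ← div_le_iff₀' hCpos] at h1
    have hint := H.integrable_gain hb g
    have h2 : ∫ ω, |APT.gain P ε b g ω| ∂P ≤ -inner ℝ β g + 2 * η := by
      have h4 : ∫ ω, |APT.gain P ε b g ω| ∂P ≤ ∫ ω, (APT.gain P ε b g ω + 2 * η) ∂P := by
        refine integral_mono_ae hint.abs (hint.add (integrable_const _)) ?_
        filter_upwards [hgain] with ω hω
        exact abs_le.2 ⟨by linarith, by linarith⟩
      rwa [integral_add hint (integrable_const _), H.integral_gain hb, integral_const,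
        probReal_univ, one_smul] at h4
    have h5 : |inner ℝ β g| ≤ ∫ ω, |APT.gain P ε b g ω| ∂P := by
      rw [← abs_neg, ← H.integral_gain hb]
      exact abs_integral_le_integral_abs
    have h6 : ∫ ω, |H.isometry g ω| ∂P ≤ ∫ ω, (|APT.gain P ε b g ω| + |inner ℝ β g|) ∂P := by
      refine integral_mono_ae ((Lp.memLp _).integrable (by norm_num)).abs
        (hint.abs.add (integrable_const _)) ?_
      filter_upwards [H.gain_ae_eq_gainOp hb g, H.gainOp_ae_eq hb g] with ω h7 h8
      rw [h8] at h7
      rw [h7]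
      have := abs_add_le (H.isometry g ω - inner ℝ β g) (inner ℝ β g)
      rwa [sub_add_cancel] at this
    rw [integral_add hint.abs (integrable_const _), integral_const, probReal_univ, one_smul] at h6
    linarith
  -- The unit sphere is not convex. For `η ≤ 1 / (8 * C)` the previous inequality forces `⟨β, g⟩ ≤
  -- -1 / (4 * C)`, so this convex slice of the ball, which excludes `0`, can replace it.
  set K : Set APT.Ell2 := Metric.closedBall 0 1 ∩ {g | innerSL ℝ β g ≤ -(1 / (4 * C))} with hK
  obtain ⟨m, hm, hmK⟩ := H.exists_pos_le_shortfall hb 0 (K := K)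
    (Metric.isClosed_closedBall.inter
      (isClosed_le (innerSL ℝ β).continuous continuous_const))
    ((convex_closedBall 0 1).inter
      (convex_halfSpace_le (innerSL ℝ β).toLinearMap.isLinear _))
    (Metric.isBounded_closedBall.subset inter_subset_left) (by
      rintro g ⟨-, hg⟩ hgain
      have h0 : g = 0 := H.eq_zero_of_gain_nonneg hb hpos hneg (by
        filter_upwards [hgain, Lp.coeFn_zero ℝ 2 P] with ω h1 h2
        rwa [h2] at h1)
      rw [h0, mem_ofPred, map_zero] at hg
      have : 0 < 1 / (4 * C) := by positivity
      linarith)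
  set y' := max y 1 with hy'
  have hy'pos : 0 < y' := lt_of_lt_of_le one_pos (le_max_right _ _)
  set κ := min m (1 / (8 * C)) with hκ
  have hκpos : 0 < κ := lt_min hm (by positivity)
  -- A strategy of larger norm, normalised, loses at most `η < κ`. It then lies in `K` with
  -- shortfall at most `η < m`, a contradiction.
  refine ⟨y' / κ, fun h hh => ?_⟩
  by_contra! hcon
  have hr : 0 < ‖h‖ := lt_trans (by positivity) hcon
  set η := y' / ‖h‖ with hη
  have hηpos : 0 < η := by positivity
  have hηκ : η < κ := by
    rw [hη, div_lt_iff₀ hr]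
    rwa [div_lt_iff₀' hκpos] at hcon
  set g := ‖h‖⁻¹ • h with hg
  have hg1 : ‖g‖ = 1 := by
    rw [hg, norm_smul, norm_inv, norm_norm, inv_mul_cancel₀ hr.ne']
  have hgain : ∀ᵐ ω ∂P, -η ≤ APT.gain P ε b g ω := by
    filter_upwards [hh, H.gain_smul hb ‖h‖⁻¹ h] with ω h1 h2
    rw [hg, h2, hη, div_eq_inv_mul, ← mul_neg]
    refine mul_le_mul_of_nonneg_left (le_trans ?_ h1) (by positivity)
    exact neg_le_neg (le_max_left _ _)
  have hgK : g ∈ K := by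
    refine ⟨by simp [hg1], ?_⟩
    have h1 := hβle g η hg1 hηpos.le hgain
    have h2 : η < 1 / (8 * C) := hηκ.trans_le (min_le_right _ _)
    have e1 : 1 / (8 * C) = 1 / C / 8 := by field_simp
    have e2 : 1 / (4 * C) = 1 / C / 4 := by field_simp
    rw [mem_ofPred, innerSL_apply_apply, e2]
    rw [e1] at h2
    linarith
  have hle : H.shortfall hb 0 g ≤ η := by
    refine abs_le_of_sq_le_sq' ?_ hηpos.le |>.2
    rw [H.shortfall_sq]
    have h1 : ∫ ω, max ((0 : Lp ℝ 2 P) ω - APT.gain P ε b g ω) 0 ^ 2 ∂P ≤ ∫ _ω, η ^ 2 ∂P := by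
      refine integral_mono_of_nonneg (ae_of_all _ fun ω => by positivity) (integrable_const _) ?_
      filter_upwards [hgain, Lp.coeFn_zero ℝ 2 P] with ω h1 h2
      rw [h2, Pi.zero_apply]
      exact pow_le_pow_left₀ (le_max_right _ _) (max_le (by linarith) hηpos.le) 2
    simpa using h1
  have := hmK g hgK
  have := min_le_left m (1 / (8 * C))
  linarith

end IsFactorModel

end

/-! ### Value functions, indifference prices and their limit. -/

noncomputable section

variable {Ω : Type*} [MeasurableSpace Ω]

namespace IsFactorModel

variable {P : Measure Ω} {ε : ℕ → Ω → ℝ} {b : ℕ → ℝ}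
  {U : ℝ → ℝ} {G : Ω → ℝ}

theorem integrable_wealth [IsProbabilityMeasure P] (H : IsFactorModel P ε) (hb : Memℓp b 2)
    (y : ℝ) (h : APT.Ell2) : Integrable (APT.wealth P ε b y h) P :=
  (integrable_const y).add (H.integrable_gain hb h)

theorem integrable_wealth_sub [IsProbabilityMeasure P] (H : IsFactorModel P ε) (hb : Memℓp b 2) (hG : Integrable G P)
    (y : ℝ) (h : APT.Ell2) : Integrable (fun ω => APT.wealth P ε b y h ω - G ω) P :=
  (H.integrable_wealth hb y h).sub hG

theorem integral_wealth_sub_le [IsProbabilityMeasure P] (H : IsFactorModel P ε) (hb : Memℓp b 2) (hG : Integrable G P)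
    (hG0 : 0 ≤ᵐ[P] G) (y : ℝ) (h : APT.Ell2) :
    ∫ ω, (APT.wealth P ε b y h ω - G ω) ∂P ≤ y + ‖(⟨b, hb⟩ : APT.Ell2)‖ * ‖h‖ := by
  have h1 : ∫ ω, APT.wealth P ε b y h ω ∂P = y - inner ℝ (⟨b, hb⟩ : APT.Ell2) h := by
    simp only [APT.wealth]
    rw [integral_add (integrable_const y) (H.integrable_gain hb h), H.integral_gain hb,
      integral_const, probReal_univ, one_smul, sub_eq_add_neg]
  rw [integral_sub (H.integrable_wealth hb y h) hG, h1]
  have h2 := integral_nonneg_of_ae hG0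
  have h3 := neg_le_of_abs_le (abs_real_inner_le_norm (⟨b, hb⟩ : APT.Ell2) h)
  linarith

/-- By concavity `U` lies below its tangent at `1`, which is affine in the integrable surplus. -/
theorem admissible_eq_superhedging [IsProbabilityMeasure P] (H : IsFactorModel P ε) (hb : Memℓp b 2) (hU : IsUtility U)
    (hG : Integrable G P) (y : ℝ) :
    APT.admissible P ε b U G y = APT.superhedging P ε b G y := by
  refine inter_eq_right.2 fun h _ => ?_
  have hint := H.integrable_wealth_sub hb hG y h
  refine expUtilityPos_lt_top
    (Z := fun ω => U 1 + deriv U 1 * (APT.wealth P ε b y h ω - G ω - 1))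
    ((integrable_const _).add ((hint.sub (integrable_const _)).const_mul _)) ?_
  exact ae_of_all _ fun ω => hU.extendUtility_le (φ := fun t => U 1 + deriv U 1 * (t - 1))
    (by fun_prop) (fun t ht => hU.le_tangent one_pos ht) _

theorem superhedging_eq [IsProbabilityMeasure P] (hG : MemLp G 2 P) (y : ℝ) :
    APT.superhedging P ε b G y =
      {h | ∀ᵐ ω ∂P, ((hG.sub (memLp_const y)).toLp : Lp ℝ 2 P) ω ≤ APT.gain P ε b h ω} := by
  ext h
  simp only [APT.superhedging, mem_ofPred]
  constructor <;> intro hh <;>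
    filter_upwards [hh, (hG.sub (memLp_const y)).coeFn_toLp] with ω h1 h2
  · rw [h2, Pi.sub_apply]
    simp only [APT.wealth] at h1
    linarith
  · rw [h2, Pi.sub_apply] at h1
    simp only [APT.wealth]
    linarith

theorem neg_le_gain_of_mem_superhedging (hG0 : 0 ≤ᵐ[P] G) {y : ℝ} {h : APT.Ell2}
    (hh : h ∈ APT.superhedging P ε b G y) : ∀ᵐ ω ∂P, -y ≤ APT.gain P ε b h ω := by
  filter_upwards [hh, hG0] with ω h1 h2
  simp only [APT.wealth, Pi.zero_apply] at h1 h2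
  linarith

theorem superhedging_mono {y z : ℝ} (hyz : y ≤ z) :
    APT.superhedging P ε b G y ⊆ APT.superhedging P ε b G z := by
  intro h hh
  change ∀ᵐ ω ∂P, G ω ≤ APT.wealth P ε b z h ω
  filter_upwards [hh] with ω hω
  simp only [APT.wealth] at hω ⊢
  linarith

/-- The tangent at `1` reduces the claim to a bound on expected surplus, which follows from
boundedness of the superhedging strategies. -/
theorem valueFn_lt_top [IsProbabilityMeasure P] (H : IsFactorModel P ε) (hb : Memℓp b 2)
    (hpos : ∀ i, 0 < P {ω | b i < ε i ω}) (hneg : ∀ i, 0 < P {ω | ε i ω < b i})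
    {M : ℝ} (h3 : ∀ i, MemLp (ε i) 3 P) (hM : ∀ i, ∫ ω, |ε i ω| ^ 3 ∂P ≤ M)
    (hU : IsUtility U) (hG : Integrable G P) (hG0 : 0 ≤ᵐ[P] G) (y : ℝ) :
    APT.valueFn P ε b U G y < ⊤ := by
  obtain ⟨R, hR⟩ := H.exists_norm_le_of_neg_le_gain hb hpos hneg h3 hM y
  refine lt_of_le_of_lt (iSup₂_le (a := ((U 1 + deriv U 1 *
    (y + ‖(⟨b, hb⟩ : APT.Ell2)‖ * R - 1) : ℝ) : EReal)) fun h hh => ?_) (EReal.coe_lt_top _)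
  have hint := H.integrable_wealth_sub hb hG y h
  have hint' : Integrable (fun ω => APT.wealth P ε b y h ω - G ω - 1) P :=
    hint.sub (integrable_const _)
  refine (expUtility_le_integral
    (Z := fun ω => U 1 + deriv U 1 * (APT.wealth P ε b y h ω - G ω - 1))
    ((integrable_const _).add (hint'.const_mul _))
    (ae_of_all _ fun ω => hU.extendUtility_le (φ := fun t => U 1 + deriv U 1 * (t - 1))
      (by fun_prop) (fun t ht => hU.le_tangent one_pos ht) _)).trans ?_
  rw [EReal.coe_le_coe_iff, integral_add (integrable_const _) (hint'.const_mul _), integral_const_mul,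
    integral_sub hint (integrable_const _)]
  simp only [integral_const, probReal_univ, one_smul]
  have h1 := H.integral_wealth_sub_le hb hG hG0 y h
  have h2 := hR h (neg_le_gain_of_mem_superhedging hG0 hh.2)
  have h4 := (hU.deriv_pos one_pos).le
  have h5 : ‖(⟨b, hb⟩ : APT.Ell2)‖ * ‖h‖ ≤ ‖(⟨b, hb⟩ : APT.Ell2)‖ * R := by gcongr
  have h6 := mul_le_mul_of_nonneg_left (h1.trans (add_le_add_right h5 y)) h4
  linarith

theorem le_valueFn_zero [IsProbabilityMeasure P] (H : IsFactorModel P ε) (hb : Memℓp b 2) (hU : IsUtility U) {x : ℝ}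
    (hx : 0 < x) : (U x : EReal) ≤ APT.valueFn P ε b U 0 x := by
  have hw : ∀ᵐ ω ∂P, x ≤ APT.wealth P ε b x 0 ω := by
    filter_upwards [H.gain_zero hb] with ω hω
    simp [APT.wealth, hω]
  have hmem : (0 : APT.Ell2) ∈ APT.admissible P ε b U 0 x := by
    rw [H.admissible_eq_superhedging hb hU (integrable_zero _ _ _)]
    filter_upwards [hw] with ω hω
    exact hx.le.trans hω
  rw [← expUtility_const (P := P) hx]
  refine (hU.expUtility_mono ?_).trans (le_iSup₂_of_le 0 hmem le_rfl)
  simpa using hw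

theorem indiffPrice_le_superPrice [IsProbabilityMeasure P] (H : IsFactorModel P ε) (hb : Memℓp b 2) (hU : IsUtility U)
    (hG : Integrable G P) (x : ℝ) :
    APT.indiffPrice P ε b U G x ≤ APT.superPrice P ε b G := by
  refine le_iInf₂ fun z hz => ?_
  obtain ⟨g, hg⟩ := hz
  refine iInf₂_le_of_le z (iSup₂_le fun h hh => ?_) le_rfl
  rw [H.admissible_eq_superhedging hb hU (integrable_zero _ _ _)] at hh
  have hle : ∀ᵐ ω ∂P, APT.wealth P ε b x h ω - (0 : Ω → ℝ) ω ≤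
      APT.wealth P ε b (x + z) (h + g) ω - G ω := by
    filter_upwards [hg, H.gain_add hb h g] with ω h1 h2
    simp only [APT.wealth, h2, Pi.zero_apply] at h1 ⊢
    linarith
  refine (hU.expUtility_mono hle).trans (le_iSup₂_of_le (h + g) ?_ le_rfl)
  rw [H.admissible_eq_superhedging hb hU hG]
  change ∀ᵐ ω ∂P, G ω ≤ APT.wealth P ε b (x + z) (h + g) ω
  filter_upwards [hle, hh] with ω h1 h2
  simp only [Pi.zero_apply] at h1 h2
  linarith

/-- Without a superhedging strategy the right-hand value is `⊥`, whereas the left-hand one is at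
least `U x`. -/
theorem superhedging_nonempty_of_le_valueFn [IsProbabilityMeasure P] (H : IsFactorModel P ε) (hb : Memℓp b 2)
    (hU : IsUtility U) {x : ℝ} (hx : 0 < x) {y : ℝ}
    (hle : APT.valueFn P ε b U 0 x ≤ APT.valueFn P ε b U G y) :
    (APT.superhedging P ε b G y).Nonempty := by
  by_contra hempty
  rw [not_nonempty_iff_eq_empty] at hempty
  have h1 : APT.valueFn P ε b U G y = ⊥ := by
    simp [APT.valueFn, APT.admissible, hempty]
  have h2 := (H.le_valueFn_zero hb hU hx).trans hle
  rw [h1, le_bot_iff] at h2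
  exact EReal.coe_ne_bot _ h2

/-- As `G ≥ 0`, superhedging from `x + z` bounds losses by `x + z`, and absence of arbitrage makes
this bound nonnegative. So `-x` is a lower bound. -/
theorem bot_lt_indiffPrice [IsProbabilityMeasure P] (H : IsFactorModel P ε) (hb : Memℓp b 2)
    (hpos : ∀ i, 0 < P {ω | b i < ε i ω}) (hneg : ∀ i, 0 < P {ω | ε i ω < b i})
    (hU : IsUtility U) (hG0 : 0 ≤ᵐ[P] G) {x : ℝ} (hx : 0 < x) :
    ⊥ < APT.indiffPrice P ε b U G x := by
  refine lt_of_lt_of_le (EReal.bot_lt_coe (-x)) (le_iInf₂ fun z hz => ?_)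
  obtain ⟨h, hh⟩ := H.superhedging_nonempty_of_le_valueFn hb hU hx hz
  have := H.nonneg_of_neg_le_gain hb hpos hneg (neg_le_gain_of_mem_superhedging hG0 hh)
  rw [EReal.coe_le_coe_iff]
  linarith

theorem indiffPrice_lt_top_iff [IsProbabilityMeasure P] (H : IsFactorModel P ε) (hb : Memℓp b 2) (hU : IsUtility U)
    (hG : Integrable G P) {x : ℝ} (hx : 0 < x) :
    APT.indiffPrice P ε b U G x < ⊤ ↔ APT.superPrice P ε b G < ⊤ := by
  refine ⟨fun hlt => ?_, (H.indiffPrice_le_superPrice hb hU hG x).trans_lt⟩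
  obtain ⟨z, hz⟩ := iInf_lt_iff.1 hlt
  obtain ⟨hz, -⟩ := iInf_lt_iff.1 hz
  exact (iInf₂_le (x + z) (H.superhedging_nonempty_of_le_valueFn hb hU hx hz)).trans_lt
    (EReal.coe_lt_top _)

/-- If `G` cannot be superhedged from `z`, then starting from `x + z` the surplus over `G` falls
short of `x` by a definite amount, which bounds its expected utility for every utility function. -/
theorem exists_valueFn_le [IsProbabilityMeasure P] (H : IsFactorModel P ε) (hb : Memℓp b 2)
    (hpos : ∀ i, 0 < P {ω | b i < ε i ω}) (hneg : ∀ i, 0 < P {ω | ε i ω < b i})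
    {M : ℝ} (h3 : ∀ i, MemLp (ε i) 3 P) (hM : ∀ i, ∫ ω, |ε i ω| ^ 3 ∂P ≤ M)
    (hG : MemLp G 2 P) (hG0 : 0 ≤ᵐ[P] G) {x z : ℝ} (hx : 0 < x)
    (hz : ¬ (APT.superhedging P ε b G z).Nonempty) :
    ∃ a, 0 < a ∧ a < x ∧ ∃ σ > 0, ∃ C, ∀ U : ℝ → ℝ, IsUtility U →
      APT.valueFn P ε b U G (x + z) ≤ ((U x - deriv U a * σ + deriv U x * C : ℝ) : EReal) := by
  obtain ⟨R, hR⟩ := H.exists_norm_le_of_neg_le_gain hb hpos hneg h3 hM (x + z)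
  have hG1 : Integrable G P := hG.integrable (by norm_num)
  set D : Lp ℝ 2 P := (hG.sub (memLp_const z)).toLp with hD
  set K := APT.superhedging P ε b G (x + z) with hK
  obtain ⟨m, hm, hmK⟩ := H.exists_pos_le_shortfall hb D (K := K)
    (by rw [hK, superhedging_eq hG]; exact H.isClosed_setOf_le_gain hb _)
    (by rw [hK, superhedging_eq hG]; exact H.convex_setOf_le_gain hb _)
    (isBounded_iff_forall_norm_le.2
      ⟨R, fun h hh => hR h (neg_le_gain_of_mem_superhedging hG0 hh)⟩)
    (fun h _ hh => hz ⟨h, by rw [superhedging_eq hG]; exact hh⟩)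
  set τ := m ^ 2 / x with hτ
  have hτpos : 0 < τ := by positivity
  -- Lowering the kink from `x` to `x - α` costs at most `τ / 2` of the mean shortfall `τ`, and `α ≤
  -- x / 2` keeps the kink in the domain of `U`.
  set α := min (τ / 2) (x / 2) with hα
  have hαpos : 0 < α := lt_min (by positivity) (by positivity)
  have hατ : α ≤ τ / 2 := min_le_left _ _
  have hαx : α ≤ x / 2 := min_le_right _ _
  have ha : 0 < x - α := by linarith
  refine ⟨x - α, ha, by linarith, τ / 2, by positivity,
    x + z + ‖(⟨b, hb⟩ : APT.Ell2)‖ * R, fun U hU => iSup₂_le fun h hh => ?_⟩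
  set W : Ω → ℝ := fun ω => APT.wealth P ε b (x + z) h ω - G ω with hW
  have hWint : Integrable W P := H.integrable_wealth_sub hb hG1 _ h
  have hWnn : ∀ᵐ ω ∂P, 0 ≤ W ω := by
    filter_upwards [hh.2] with ω hω
    exact sub_nonneg.2 hω
  have hint : ∀ c : ℝ, Integrable (fun ω => max (c - W ω) 0) P := fun c =>
    ((integrable_const c).sub hWint).pos_part
  have hint' : Integrable (fun ω => max (W ω - x) 0) P :=
    (hWint.sub (integrable_const x)).pos_part
  have hshort : τ ≤ ∫ ω, max (x - W ω) 0 ∂P := by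
    have h1 : m ^ 2 ≤ H.shortfall hb D h ^ 2 := pow_le_pow_left₀ hm.le (hmK h hh.2) 2
    -- Since `W ≥ 0`, the shortfall `(x - W)⁺` is at most `x`, so its square is at most `x` times
    -- itself: the `L²` bound becomes an `L¹` bound.
    have h2 : ∫ ω, max (D ω - APT.gain P ε b h ω) 0 ^ 2 ∂P ≤ ∫ ω, x * max (x - W ω) 0 ∂P := by
      refine integral_mono_of_nonneg (ae_of_all _ fun ω => by positivity)
        ((hint x).const_mul x) ?_
      filter_upwards [hWnn, (hG.sub (memLp_const z)).coeFn_toLp] with ω h4 h5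
      have h6 : D ω - APT.gain P ε b h ω = x - W ω := by
        rw [hD, h5, Pi.sub_apply, hW]
        simp only [APT.wealth]
        ring
      rw [h6, sq]
      exact mul_le_mul_of_nonneg_right (max_le (by linarith) hx.le) (le_max_right _ _)
    rw [H.shortfall_sq] at h1
    rw [integral_const_mul] at h2
    rw [hτ, div_le_iff₀' hx]
    exact h1.trans h2
  have hlow : τ / 2 ≤ ∫ ω, max (x - α - W ω) 0 ∂P := by
    have h1 : ∫ ω, (max (x - W ω) 0 - α) ∂P ≤ ∫ ω, max (x - α - W ω) 0 ∂P := by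
      refine integral_mono ((hint x).sub (integrable_const _)) (hint _) fun ω => ?_
      change max (x - W ω) 0 - α ≤ max (x - α - W ω) 0
      rw [sub_le_iff_le_add]
      have h4 := le_max_left (x - α - W ω) 0
      have h5 := le_max_right (x - α - W ω) 0
      exact max_le (by linarith) (by linarith)
    rw [integral_sub (hint x) (integrable_const _), integral_const, probReal_univ,
      one_smul] at h1
    linarith
  have hup : ∫ ω, max (W ω - x) 0 ∂P ≤ x + z + ‖(⟨b, hb⟩ : APT.Ell2)‖ * R := by
    have h1 : ∫ ω, max (W ω - x) 0 ∂P ≤ ∫ ω, W ω ∂P := by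
      refine integral_mono_ae hint' hWint ?_
      filter_upwards [hWnn] with ω hω
      exact max_le (by linarith) hω
    refine (h1.trans (H.integral_wealth_sub_le hb hG1 hG0 _ h)).trans ?_
    have h2 := hR h (neg_le_gain_of_mem_superhedging hG0 hh.2)
    gcongr
  have hJ : Integrable (fun ω => U x - deriv U (x - α) * max (x - α - W ω) 0) P :=
    (integrable_const _).sub ((hint _).const_mul _)
  have hJ' : Integrable (fun ω => deriv U x * max (W ω - x) 0) P := hint'.const_mul _
  refine (expUtility_le_integral (hJ.add hJ') (ae_of_all _ fun ω =>
    hU.extendUtility_le (φ := fun t => U x - deriv U (x - α) * max (x - α - t) 0 +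
      deriv U x * max (t - x) 0) (by fun_prop)
      (fun t ht => hU.le_kinked_bound ha (by linarith) ht) _)).trans ?_
  rw [EReal.coe_le_coe_iff]
  simp only [Pi.add_apply]
  rw [integral_add hJ hJ', integral_sub (integrable_const _) ((hint _).const_mul _),
    integral_const_mul, integral_const_mul, integral_const, probReal_univ, one_smul]
  have e1 := mul_le_mul_of_nonneg_left hlow (hU.deriv_pos ha).le
  have e2 := mul_le_mul_of_nonneg_left hup (hU.deriv_pos hx).le
  linarith

theorem tendsto_indiffPrice [IsProbabilityMeasure P] (H : IsFactorModel P ε) (hb : Memℓp b 2)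
    (hpos : ∀ i, 0 < P {ω | b i < ε i ω}) (hneg : ∀ i, 0 < P {ω | ε i ω < b i})
    {M : ℝ} (h3 : ∀ i, MemLp (ε i) 3 P) (hM : ∀ i, ∫ ω, |ε i ω| ^ 3 ∂P ≤ M)
    (hG : MemLp G 2 P) (hG0 : 0 ≤ᵐ[P] G) {x : ℝ} (hx : 0 < x) {U : ℕ → ℝ → ℝ}
    (hU : ∀ n, IsUtility (U n))
    (hra : ∀ y : ℝ, 0 < y → Tendsto (fun n => APT.riskAversion (U n) y) atTop atTop) :
    Tendsto (fun n => APT.indiffPrice P ε b (U n) G x) atTop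
      (𝓝 (APT.superPrice P ε b G)) := by
  have hG1 : Integrable G P := hG.integrable (by norm_num)
  refine tendsto_order.2 ⟨fun c hc => ?_, fun c hc => Eventually.of_forall fun n =>
    (H.indiffPrice_le_superPrice hb (hU n) hG1 x).trans_lt hc⟩
  obtain ⟨z, hcz, hz⟩ := EReal.lt_iff_exists_real_btwn.1 hc
  have hempty : ¬ (APT.superhedging P ε b G z).Nonempty := fun hne =>
    not_lt.2 (iInf₂_le z hne) hz
  obtain ⟨a, ha, hax, σ, hσ, C, hC⟩ :=
    H.exists_valueFn_le hb hpos hneg h3 hM hG hG0 hx hempty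
  -- Beyond the threshold `C / σ` the penalty `deriv (U n) a * σ` exceeds the credit `deriv (U n) x
  -- * C`.
  filter_upwards [(IsUtility.tendsto_deriv_div_deriv hU hra ha hax).eventually_gt_atTop
    (C / σ)] with n hn
  refine hcz.trans_le (le_iInf₂ fun y hy => ?_)
  rw [EReal.coe_le_coe_iff]
  by_contra! hyz
  have hlt : U n x - deriv (U n) a * σ + deriv (U n) x * C < U n x := by
    have hd := (hU n).deriv_pos hx
    rw [div_lt_div_iff₀ hσ hd] at hn
    linarith
  -- A single `z` suffices: monotonicity in initial wealth excludes every `y < z` from the set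
  -- defining the price.
  have hmono : APT.valueFn P ε b (U n) G (x + y) ≤ APT.valueFn P ε b (U n) G (x + z) := by
    refine iSup₂_le fun h hh => ?_
    rw [H.admissible_eq_superhedging hb (hU n) hG1] at hh
    refine ((hU n).expUtility_mono (ae_of_all _ fun ω => ?_)).trans (le_iSup₂_of_le h ?_ le_rfl)
    · simp only [APT.wealth]
      linarith
    · rw [H.admissible_eq_superhedging hb (hU n) hG1]
      exact superhedging_mono (by linarith) hh
  have hchain := (((H.le_valueFn_zero hb (hU n) hx).trans hy).trans hmono).trans (hC _ (hU n))
  rw [EReal.coe_le_coe_iff] at hchain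
  linarith

end IsFactorModel

theorem memLp_three_and_integral_le {P : Measure Ω} {ε : ℕ → Ω → ℝ}
    (hmeas : ∀ i, Measurable (ε i)) (hthird : (⨆ i, ∫⁻ ω, ‖ε i ω‖ₑ ^ 3 ∂P) < ⊤) (i : ℕ) :
    MemLp (ε i) 3 P ∧
      ∫ ω, |ε i ω| ^ 3 ∂P ≤ (⨆ i, ∫⁻ ω, ‖ε i ω‖ₑ ^ 3 ∂P).toReal := by
  have hle : ∫⁻ ω, ‖ε i ω‖ₑ ^ 3 ∂P ≤ ⨆ i, ∫⁻ ω, ‖ε i ω‖ₑ ^ 3 ∂P :=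
    le_iSup (fun i => ∫⁻ ω, ‖ε i ω‖ₑ ^ 3 ∂P) i
  refine ⟨⟨(hmeas i).aestronglyMeasurable, ?_⟩, ?_⟩
  · rw [eLpNorm_lt_top_iff_lintegral_rpow_enorm_lt_top (by norm_num) (by norm_num)]
    convert hle.trans_lt hthird using 4
    norm_num
  · rw [integral_eq_lintegral_of_nonneg_ae (ae_of_all _ fun ω => by positivity)
      (((hmeas i).abs.pow_const 3).aestronglyMeasurable)]
    refine ENNReal.toReal_mono hthird.ne (le_trans (le_of_eq ?_) hle)
    refine lintegral_congr fun ω => ?_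
    rw [ENNReal.ofReal_pow (abs_nonneg _), Real.enorm_eq_ofReal_abs]

end

theorem theorem3 {Ω : Type*} [MeasurableSpace Ω] (P : Measure Ω) [IsProbabilityMeasure P]
    (ε : ℕ → Ω → ℝ) (b : ℕ → ℝ)
    -- the sources of risk are independent, centred, with unit variance
    (hε_meas : ∀ i, Measurable (ε i))
    (hε_L2 : ∀ i, MemLp (ε i) 2 P)
    (hε_indep : iIndepFun ε P)
    (hε_mean : ∀ i, ∫ ω, ε i ω ∂P = 0)
    (hε_var : ∀ i, ∫ ω, ε i ω ^ 2 ∂P = 1)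
    -- `b` is square-summable
    (hb : Memℓp b 2)
    -- no arbitrage in each single source of risk
    (hpos : ∀ i, 0 < P {ω | b i < ε i ω})
    (hneg : ∀ i, 0 < P {ω | ε i ω < b i})
    -- uniformly bounded third moments
    (hthird : (⨆ i, ∫⁻ ω, ‖ε i ω‖ₑ ^ 3 ∂P) < ⊤)
    -- the utility functions on `]0, ∞[`, with risk aversion tending pointwise to infinity
    (U : ℕ → ℝ → ℝ)
    (hU_conc : ∀ n, ConcaveOn ℝ (Set.Ioi 0) (U n))
    (hU_mono : ∀ n, StrictMonoOn (U n) (Set.Ioi 0))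
    (hU_C2 : ∀ n, ContDiffOn ℝ 2 (U n) (Set.Ioi 0))
    (hU_ra : ∀ y : ℝ, 0 < y → Tendsto (fun n => APT.riskAversion (U n) y) atTop atTop)
    (x : ℝ) (hx : 0 < x)
    (G : Ω → ℝ) (hG_L2 : MemLp G 2 P) (hG_nonneg : 0 ≤ᵐ[P] G) :
    -- the prices are well defined: expected utilities make sense for all superreplicating
    -- strategies, the value functions are below infinity, the reference value is finite, and
    -- the prices are above minus infinity, and finite exactly when `π(G)` is
    (∀ n,
      (∀ y : ℝ, APT.admissible P ε b (U n) G y = APT.superhedging P ε b G y ∧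
        APT.admissible P ε b (U n) 0 y = APT.superhedging P ε b 0 y ∧
        APT.valueFn P ε b (U n) G y < ⊤) ∧
      ⊥ < APT.valueFn P ε b (U n) 0 x ∧ APT.valueFn P ε b (U n) 0 x < ⊤ ∧
      ⊥ < APT.indiffPrice P ε b (U n) G x ∧
      (APT.indiffPrice P ε b (U n) G x < ⊤ ↔ APT.superPrice P ε b G < ⊤)) ∧
    -- convergence to the superreplication price
    Tendsto (fun n => APT.indiffPrice P ε b (U n) G x) atTop (𝓝 (APT.superPrice P ε b G)) := by
  have H : IsFactorModel P ε := ⟨hε_meas, hε_L2, hε_indep, hε_mean, hε_var⟩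
  have h3 := fun i => (memLp_three_and_integral_le hε_meas hthird i).1
  have hM := fun i => (memLp_three_and_integral_le hε_meas hthird i).2
  have hU : ∀ n, IsUtility (U n) := fun n => ⟨hU_conc n, hU_mono n, hU_C2 n⟩
  have hG1 : Integrable G P := hG_L2.integrable (by norm_num)
  have h0 : Integrable (0 : Ω → ℝ) P := integrable_zero _ _ _
  refine ⟨fun n => ⟨fun y => ⟨H.admissible_eq_superhedging hb (hU n) hG1 y,
    H.admissible_eq_superhedging hb (hU n) h0 y,
    H.valueFn_lt_top hb hpos hneg h3 hM (hU n) hG1 hG_nonneg y⟩,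
    (EReal.bot_lt_coe _).trans_le (H.le_valueFn_zero hb (hU n) hx),
    H.valueFn_lt_top hb hpos hneg h3 hM (hU n) h0 (ae_of_all _ fun _ => le_rfl) x,
    H.bot_lt_indiffPrice hb hpos hneg (hU n) hG_nonneg hx,
    H.indiffPrice_lt_top_iff hb (hU n) hG1 hx⟩,
    H.tendsto_indiffPrice hb hpos hneg h3 hM hG_L2 hG_nonneg hx hU hU_ra⟩
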